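/- Let $\mathbb{F}_q$ be the finite field with $q$ elements, let $f_1,\ldots,f_r\in\mathbb{F}_q[x_1,\ldots,x_n]$ be polynomials of total degrees $d_1,\ldots,d_r$, and put $d=d_1+\cdots+d_r$ (the zero polynomial is given degree $0$). Let \[z=\{\mathbf{x}\in\mathbb{F}_q^n: f_1(\mathbf{x})=\cdots=f_r(\mathbf{x})=0\},\qquad N=\#z.\] Suppose that $n>d$ and that $z$ is non-empty and is not an affine linear subspace of $\mathbb{F}_q^n$ (that is, not a translate of a vector subspace). Then (i) for any $q$ we have $N>q^{n-d}$; (ii) if $q\ge 4$ we have $N\ge 2q^{n-d}$; and (iii) for any $q$ we have $N\ge q^{n+1-d}/(n+2-d)$, provided that each of the polynomials $f_1,\ldots,f_r$ is homogeneous. -/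

import Mathlib

/-- The common zeros in `S` of the tuple of polynomials `f`. -/
def zeroSet {F : Type*} [CommSemiring F] {n r : ℕ}
    (f : Fin r → MvPolynomial (Fin n) F) (S : Set (Fin n → F)) : Set (Fin n → F) :=
  {x | x ∈ S ∧ ∀ i, MvPolynomial.eval x (f i) = 0}

/-- The number of common zeros in `S` of the tuple `f` (over a finite field this set is finite). -/
noncomputable def numZeros {F : Type*} [CommSemiring F] {n r : ℕ}
    (f : Fin r → MvPolynomial (Fin n) F) (S : Set (Fin n → F)) : ℕ :=
  (zeroSet f S).ncard

/-- The sum of the total degrees of the polynomials in the tuple `f`. -/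
noncomputable def degreeSum {F : Type*} [CommSemiring F] {n r : ℕ}
    (f : Fin r → MvPolynomial (Fin n) F) : ℕ :=
  ∑ i, (f i).totalDegree

/-! Write q = p^f for the field size, d for the degree sum and N for the number of zeros. Everything
rests on one congruence: parallel affine subspaces of dimension at least d contain equally many
common zeros modulo q (`cosetCount_zeroFinset_modEq`). By an affine parametrization the two
subspaces become u = 0 and u = 1 for a distinguished coordinate u. Modulo p^f, zeros are counted in
the Witt vectors by summing products of 1 - E^K, where E lifts the value of a polynomial. In the
difference of the two counts only monomials involving u survive. Summed over Teichmüller values of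
the other coordinates, such a monomial gives a multiple of q unless all their exponents are positive
multiples of q - 1. In that case a degree count, made for each of the f cyclic shifts of base p
digits, forces q to divide the multinomial coefficient (`pow_dvd_prod_multinomial`). The rest is
combinatorics of a set with this property (`ParallelCongruent`). A set that is not affine has a
section of dimension 1 or 2 with a "bad" count; enlarge it one dimension at a time while the count
stays bad. If dimension d is reached, the congruence carries the residue to all q^(n-d) parallel
cosets. If the process stops earlier, every one-dimensional extension has a good count, hence gains
points, and double counting over extensions (`mul_pow_sub_one_le_of_extensions`) produces enough
zeros. The bounds differ in what "bad" means: not divisible by q for (i), below q for (ii), and, for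
a cone, fewer lines through the origin than a full plane contains for (iii). For cones this yields
q^(n-d+1) ≤ 2N, stronger than (iii). -/

/-! ### Cyclic shifts of base p digits. -/

/-- The number whose base `p` digits are those of the list `L`, where the digit in position `a`
is moved to the position `(a + i) mod f`. -/
def cyclicDigits (p f : ℕ) : ℕ → List ℕ → ℕ
  | _, [] => 0
  | i, d :: L => d * p ^ (i % f) + cyclicDigits p f (i + 1) L

lemma pow_mod_modEq (p f i : ℕ) (hp : 0 < p) : p ^ (i % f) ≡ p ^ i [MOD (p ^ f - 1)] := by
  have h1 : p ^ f ≡ 1 [MOD (p ^ f - 1)] := by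
    have h := Nat.one_le_pow f p hp
    exact ((Nat.modEq_iff_dvd' h).2 dvd_rfl).symm
  have h2 : p ^ i = p ^ (i % f) * (p ^ f) ^ (i / f) := by
    rw [← pow_mul, ← pow_add, Nat.mod_add_div]
  rw [h2]
  simpa using ((h1.pow (i / f)).mul_left (p ^ (i % f))).symm

lemma cyclicDigits_modEq (p f : ℕ) (hp : 0 < p) (L : List ℕ) (i : ℕ) :
    cyclicDigits p f i L ≡ p ^ i * Nat.ofDigits p L [MOD (p ^ f - 1)] := by
  induction L generalizing i with
  | nil => simp [cyclicDigits, Nat.ofDigits, Nat.ModEq.refl]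
  | cons d L ih =>
    have h : p ^ i * Nat.ofDigits p (d :: L) =
        d * p ^ i + p ^ (i + 1) * Nat.ofDigits p L := by
      rw [Nat.ofDigits_cons, pow_succ]; ring
    rw [h, cyclicDigits]
    exact ((pow_mod_modEq p f i hp).mul_left d).add (ih (i + 1))

lemma cyclicDigits_pos (p f : ℕ) (hp : 0 < p) (L : List ℕ) (i : ℕ)
    (h : 0 < Nat.ofDigits p L) : 0 < cyclicDigits p f i L := by
  induction L generalizing i with
  | nil => simp [Nat.ofDigits] at h
  | cons d L ih =>
    rw [cyclicDigits]
    rcases Nat.eq_zero_or_pos d with rfl | hd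
    · have : 0 < Nat.ofDigits p L := by
        rw [Nat.ofDigits_cons] at h
        simp at h
        exact h.2
      have := ih (i + 1) this
      omega
    · have := Nat.mul_pos hd (Nat.pow_pos (n := i % f) hp)
      omega

lemma sum_pow_mod_shift (p f k : ℕ) :
    ∑ i ∈ Finset.range f, p ^ ((i + k) % f) = ∑ i ∈ Finset.range f, p ^ i := by
  induction k with
  | zero =>
    exact Finset.sum_congr rfl fun i hi => by
      rw [add_zero, Nat.mod_eq_of_lt (Finset.mem_range.1 hi)]
  | succ k ih =>
    rw [← ih]
    have h1 := Finset.sum_range_succ (fun i => p ^ ((i + k) % f)) f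
    have h2 := Finset.sum_range_succ' (fun i => p ^ ((i + k) % f)) f
    have h3 : p ^ ((f + k) % f) = p ^ ((0 + k) % f) := by simp
    have h4 : ∑ i ∈ Finset.range f, p ^ ((i + 1 + k) % f)
        = ∑ i ∈ Finset.range f, p ^ ((i + (k + 1)) % f) :=
      Finset.sum_congr rfl fun i _ => by rw [add_assoc, add_comm 1 k]
    omega

/-- Over f consecutive shifts each digit visits every position modulo f exactly once, so it is
multiplied by 1 + p + ... + p^(f-1). -/
lemma sum_cyclicDigits (p f : ℕ) (hp : 0 < p) (L : List ℕ) (k : ℕ) :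
    (p - 1) * ∑ i ∈ Finset.range f, cyclicDigits p f (i + k) L = (p ^ f - 1) * L.sum := by
  induction L generalizing k with
  | nil => simp [cyclicDigits]
  | cons d L ih =>
    have hg : (p - 1) * ∑ i ∈ Finset.range f, p ^ i = p ^ f - 1 := by
      rw [mul_comm, geom_sum_mul_of_one_le hp]
    simp only [cyclicDigits, List.sum_cons]
    rw [Finset.sum_add_distrib, ← Finset.mul_sum, sum_pow_mod_shift, mul_add, mul_add]
    have := ih (k + 1)
    simp only [← add_assoc] at this
    rw [this, mul_left_comm, hg]
    ring

/-- `R i j` stands in for p^i * j modulo p^f - 1, staying positive when j is. Its sum over i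
recovers the digit sum of j, which is what Legendre's formula needs. -/
lemma exists_cyclic_shifts (p f : ℕ) (hp : 1 < p) : ∃ R : ℕ → ℕ → ℕ,
    (∀ i j, R i j ≡ p ^ i * j [MOD (p ^ f - 1)]) ∧
    (∀ i j, 0 < j → 0 < R i j) ∧
    (∀ j, (p - 1) * ∑ i ∈ Finset.range f, R i j = (p ^ f - 1) * (p.digits j).sum) := by
  have hp0 : 0 < p := by omega
  refine ⟨fun i j => cyclicDigits p f i (p.digits j), fun i j => ?_, fun i j hj => ?_, fun j => ?_⟩
  · simpa [Nat.ofDigits_digits] using cyclicDigits_modEq p f hp0 (p.digits j) i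
  · exact cyclicDigits_pos p f hp0 _ i (by rwa [Nat.ofDigits_digits])
  · simpa using sum_cyclicDigits p f hp0 (p.digits j) 0

lemma sum_digits_pow_mul (p : ℕ) (hp : 1 < p) (k n : ℕ) :
    (p.digits (p ^ k * n)).sum = (p.digits n).sum := by
  rcases Nat.eq_zero_or_pos n with rfl | hn
  · simp
  · rw [Nat.digits_base_pow_mul hp hn]
    simp

lemma sum_digits_le (p f n : ℕ) (hp : 1 < p) (hn : n < p ^ f) :
    (p.digits n).sum ≤ f * (p - 1) := by
  have h1 : (p.digits n).length ≤ f := (Nat.digits_length_le_iff hp n).2 hn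
  have h2 : (p.digits n).sum ≤ (p.digits n).length • (p - 1) :=
    List.sum_le_card_nsmul _ _ fun d hd => by
      have := Nat.digits_lt_base hp hd
      omega
  exact h2.trans (Nat.mul_le_mul_right _ h1)

/-! ### Divisibility of multinomial coefficients. -/

/-- Legendre's formula for each factorial; the linear terms cancel. -/
lemma sub_one_mul_padicValNat_multinomial {α : Type*} (p : ℕ) [hp : Fact p.Prime]
    (s : Finset α) (κ : α → ℕ) :
    (p - 1) * padicValNat p (Nat.multinomial s κ) + (p.digits (∑ a ∈ s, κ a)).sum
      = ∑ a ∈ s, (p.digits (κ a)).sum := by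
  classical
  have hspec := Nat.multinomial_spec s κ
  have hv : ∑ a ∈ s, padicValNat p (κ a).factorial + padicValNat p (Nat.multinomial s κ)
      = padicValNat p (∑ a ∈ s, κ a).factorial := by
    rw [← hspec, padicValNat.mul (Finset.prod_ne_zero_iff.2 fun a _ => Nat.factorial_ne_zero _)
      (Nat.multinomial_pos s κ).ne']
    congr 1
    clear hspec
    induction s using Finset.induction_on with
    | empty => simp
    | insert a s ha ih =>
      rw [Finset.sum_insert ha, Finset.prod_insert ha, padicValNat.mul (Nat.factorial_ne_zero _)
        (Finset.prod_ne_zero_iff.2 fun a _ => Nat.factorial_ne_zero _), ih]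
  have hL : ∀ n, (p - 1) * padicValNat p n.factorial + (p.digits n).sum = n := fun n => by
    have := sub_one_mul_padicValNat_factorial (p := p) n
    have := Nat.digit_sum_le p n
    omega
  have h1 := hL (∑ a ∈ s, κ a)
  have h2 : ∑ a ∈ s, ((p - 1) * padicValNat p (κ a).factorial + (p.digits (κ a)).sum)
      = ∑ a ∈ s, κ a := Finset.sum_congr rfl fun a _ => hL _
  rw [Finset.sum_add_distrib, ← Finset.mul_sum] at h2
  rw [← hv, mul_add] at h1
  omega

/-- For each shift i, the shifted multiplicities of block l sum to (p^f - 1) * A i l with A i l ≥ 1.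
The degree bound rules out that all A i l equal 1, so each shift contributes an excess of at least
one; the f excesses add up to a valuation of at least f. -/
theorem pow_dvd_prod_multinomial {ι τ : Type*} [Fintype ι] [Fintype τ] (p f : ℕ)
    [hp : Fact p.Prime] (hf : 0 < f) (s : ι → Finset (Option τ →₀ ℕ)) (e : ι → ℕ)
    (hs : ∀ l, ∀ w ∈ s l, ∑ v, w v ≤ e l) (he : ∑ l, e l ≤ Fintype.card τ)
    (κ : ι → (Option τ →₀ ℕ) → ℕ) (hκ : ∀ l, ∑ w ∈ s l, κ l w = p ^ (f - 1) * (p ^ f - 1))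
    (hτ : ∀ v : τ, 0 < ∑ l, ∑ w ∈ s l, κ l w * w (some v) ∧
      p ^ f - 1 ∣ ∑ l, ∑ w ∈ s l, κ l w * w (some v))
    (hnone : 0 < ∑ l, ∑ w ∈ s l, κ l w * w none) :
    p ^ f ∣ ∏ l, Nat.multinomial (s l) (κ l) := by
  have hp1 := hp.out.one_lt
  have hq : 0 < p ^ f - 1 := by
    have := Nat.one_lt_pow hf.ne' hp1
    omega
  obtain ⟨R, hR1, hR2, hR3⟩ := exists_cyclic_shifts p f hp1
  have hA : ∀ i l, ∃ A, 1 ≤ A ∧ ∑ w ∈ s l, R i (κ l w) = (p ^ f - 1) * A := fun i l => by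
    have h1 : ∑ w ∈ s l, R i (κ l w) ≡ 0 [MOD (p ^ f - 1)] := by
      have : ∑ w ∈ s l, R i (κ l w) ≡ ∑ w ∈ s l, p ^ i * κ l w [MOD (p ^ f - 1)] :=
        Nat.ModEq.sum fun w _ => hR1 i _
      refine this.trans ?_
      rw [← Finset.mul_sum, hκ, Nat.modEq_zero_iff_dvd]
      exact (dvd_mul_left _ _).mul_left _
    obtain ⟨A, hA⟩ := (Nat.modEq_zero_iff_dvd).1 h1
    refine ⟨A, ?_, hA⟩
    by_contra hlt
    have hA0 : A = 0 := by omega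
    rw [hA0, mul_zero, Finset.sum_eq_zero_iff] at hA
    have : ∑ w ∈ s l, κ l w = 0 := Finset.sum_eq_zero fun w hw => by
      by_contra h0
      exact (hR2 i _ (Nat.pos_of_ne_zero h0)).ne' (hA w hw)
    rw [hκ] at this
    exact (Nat.mul_pos (Nat.pow_pos (n := f - 1) hp.out.pos) hq).ne' this
  choose A hA1 hA2 using hA
  have hpos : ∀ i v, 0 < ∑ l, ∑ w ∈ s l, κ l w * w v →
      0 < ∑ l, ∑ w ∈ s l, R i (κ l w) * w v := fun i v h => by
    rw [Finset.sum_pos_iff] at h ⊢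
    obtain ⟨l, hl, h⟩ := h
    refine ⟨l, hl, ?_⟩
    rw [Finset.sum_pos_iff] at h ⊢
    obtain ⟨w, hw, h⟩ := h
    exact ⟨w, hw, Nat.mul_pos (hR2 i _ (Nat.pos_of_mul_pos_right h))
      (Nat.pos_of_mul_pos_left h)⟩
  -- If all A i l were 1, the total shifted degree would be at most (p^f - 1) * |τ|. The variables
  -- in τ already use that much, and the distinguished one adds a positive amount.
  have hsum : ∀ i, Fintype.card ι + 1 ≤ ∑ l, A i l := fun i => by
    by_contra hlt
    have hall : ∀ l, A i l = 1 := by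
      have h1 : ∑ l : ι, 1 = ∑ l, A i l :=
        le_antisymm (Finset.sum_le_sum fun l _ => hA1 i l) (by simp; omega)
      exact fun l => ((Finset.sum_eq_sum_iff_of_le fun l _ => hA1 i l).1 h1 l
        (Finset.mem_univ l)).symm
    have hup : ∑ v, ∑ l, ∑ w ∈ s l, R i (κ l w) * w v ≤ (p ^ f - 1) * Fintype.card τ := by
      calc ∑ v, ∑ l, ∑ w ∈ s l, R i (κ l w) * w v
          = ∑ l, ∑ w ∈ s l, R i (κ l w) * ∑ v, w v := by
            rw [Finset.sum_comm]
            refine Finset.sum_congr rfl fun l _ => ?_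
            rw [Finset.sum_comm]
            exact Finset.sum_congr rfl fun w _ => (Finset.mul_sum _ _ _).symm
        _ ≤ ∑ l, ∑ w ∈ s l, R i (κ l w) * e l :=
            Finset.sum_le_sum fun l _ => Finset.sum_le_sum fun w hw =>
              Nat.mul_le_mul_left _ (hs l w hw)
        _ = ∑ l, (p ^ f - 1) * e l := Finset.sum_congr rfl fun l _ => by
            rw [← Finset.sum_mul, hA2, hall, mul_one]
        _ ≤ _ := by rw [← Finset.mul_sum]; exact Nat.mul_le_mul_left _ he
    have hlow : ∑ v : τ, (p ^ f - 1) ≤ ∑ v : τ, ∑ l, ∑ w ∈ s l, R i (κ l w) * w (some v) :=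
      Finset.sum_le_sum fun v _ => by
        refine Nat.le_of_dvd (hpos i _ (hτ v).1) ((Nat.modEq_zero_iff_dvd).1 ?_)
        have h1 : ∑ l, ∑ w ∈ s l, R i (κ l w) * w (some v) ≡
            ∑ l, ∑ w ∈ s l, p ^ i * κ l w * w (some v) [MOD (p ^ f - 1)] :=
          Nat.ModEq.sum fun l _ => Nat.ModEq.sum fun w _ => (hR1 i _).mul_right _
        refine h1.trans ((Nat.modEq_zero_iff_dvd).2 ?_)
        simp only [mul_assoc, ← Finset.mul_sum]
        exact (hτ v).2.mul_left _
    have hn := hpos i none hnone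
    rw [Fintype.sum_option] at hup
    simp only [Finset.sum_const, Finset.card_univ, smul_eq_mul] at hlow
    rw [mul_comm] at hlow
    omega
  have hval : ∀ l, ∑ i ∈ Finset.range f, A i l ≤ padicValNat p (Nat.multinomial (s l) (κ l)) + f :=
    fun l => by
    have h1 := sub_one_mul_padicValNat_multinomial p (s l) (κ l)
    rw [hκ, sum_digits_pow_mul p hp1] at h1
    -- The factor p^(f-1) in the exponent does not change its digit sum, so each block loses at most
    -- f.
    have h2 := sum_digits_le p f (p ^ f - 1) hp1 (by omega)
    have h3 : (p ^ f - 1) * ∑ w ∈ s l, (p.digits (κ l w)).sum =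
        (p ^ f - 1) * ((p - 1) * ∑ i ∈ Finset.range f, A i l) := by
      rw [Finset.mul_sum, mul_left_comm, Finset.mul_sum]
      simp only [← hA2, ← hR3]
      rw [Finset.sum_comm, Finset.mul_sum]
    have h4 := Nat.eq_of_mul_eq_mul_left hq h3
    have hp0 : 0 < p - 1 := by omega
    refine Nat.le_of_mul_le_mul_left ?_ hp0
    rw [mul_add, mul_comm (p - 1) f]
    omega
  have hv : f ≤ ∑ l, padicValNat p (Nat.multinomial (s l) (κ l)) := by
    have h1 := Finset.sum_le_sum fun l (_ : l ∈ Finset.univ) => hval l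
    rw [Finset.sum_comm, Finset.sum_add_distrib] at h1
    have h2 := Finset.sum_le_sum fun i (_ : i ∈ Finset.range f) => hsum i
    simp only [Finset.sum_const, Finset.card_univ, Finset.card_range, smul_eq_mul, mul_add,
      mul_one] at h1 h2
    rw [mul_comm (Fintype.card ι)] at h1
    omega
  refine (pow_dvd_pow p hv).trans ?_
  rw [← Finset.prod_pow_eq_pow_sum]
  exact Finset.prod_dvd_prod_of_dvd _ _ fun l _ => pow_padicValNat_dvd

/-! ### Witt vectors and Teichmüller lifts. -/

namespace WittVector

variable {p : ℕ} [hp : Fact p.Prime] {F : Type*} [Field F] [CharP F p]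

lemma dvd_of_constantCoeff_eq_zero [PerfectRing F p] {x : WittVector p F}
    (hx : constantCoeff x = 0) : (p : WittVector p F) ∣ x := by
  by_cases h0 : x = 0
  · simp [h0]
  obtain ⟨m, b, hb, h⟩ := exists_eq_pow_p_mul x h0
  rcases m with _ | m
  · rw [pow_zero, one_mul] at h
    rw [h] at hx
    exact absurd hx hb
  · rw [h, pow_succ', mul_assoc]
    exact dvd_mul_right _ _

lemma constantCoeff_p : constantCoeff (p : WittVector p F) = 0 := by
  rw [map_natCast, CharP.cast_eq_zero]

lemma pow_dvd_of_pow_dvd_intCast (f : ℕ) (N : ℤ)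
    (h : (p : WittVector p F) ^ f ∣ (N : WittVector p F)) : (p : ℤ) ^ f ∣ N := by
  induction f generalizing N with
  | zero => simp
  | succ f ih =>
    have h1 : (N : F) = 0 := by
      have h2 := map_dvd (constantCoeff : WittVector p F →+* F)
        ((dvd_pow_self _ (Nat.succ_ne_zero f)).trans h)
      rw [constantCoeff_p, zero_dvd_iff, map_intCast] at h2
      exact h2
    obtain ⟨M, rfl⟩ := (CharP.intCast_eq_zero_iff F p N).1 h1
    rw [pow_succ'] at h ⊢
    push_cast at h
    exact mul_dvd_mul_left _ (ih M ((mul_dvd_mul_iff_left (p_nonzero p F)).1 h))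

/-- For e = 0 every term is 1, including that of u = 0. Otherwise some unit g has g^e ≠ 1, and
multiplication by its lift permutes the terms, so the sum vanishes. -/
lemma sum_teichmuller_pow [Fintype F] (e : ℕ) (he : ¬ (0 < e ∧ Fintype.card F - 1 ∣ e)) :
    (Fintype.card F : WittVector p F) ∣ ∑ u : F, teichmuller p u ^ e := by
  rcases Nat.eq_zero_or_pos e with rfl | h0
  · simp
  · have h1 : ¬ Fintype.card F - 1 ∣ e := fun h => he ⟨h0, h⟩
    have hg : ∃ g : Fˣ, g ^ e ≠ 1 := by
      by_contra hcon
      push Not at hcon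
      apply h1
      have := (FiniteField.forall_pow_eq_one_iff F e).1 hcon
      exact this
    obtain ⟨g, hg⟩ := hg
    have hS : teichmuller p (g : F) ^ e * ∑ u : F, teichmuller p u ^ e =
        ∑ u : F, teichmuller p u ^ e := by
      rw [Finset.mul_sum]
      simp only [← mul_pow, ← map_mul]
      exact Fintype.sum_equiv (Equiv.mulLeft₀ (g : F) g.ne_zero) _ _ fun u => by simp
    have hne : teichmuller p (g : F) ^ e - 1 ≠ 0 := fun h => by
      apply hg
      have h2 := congrArg (constantCoeff : WittVector p F →+* F) h
      rw [map_sub, map_pow, map_one, map_zero, constantCoeff_apply, teichmuller_coeff_zero,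
        sub_eq_zero] at h2
      exact Units.ext (by simpa using h2)
    have : ∑ u : F, teichmuller p u ^ e = 0 := by
      have h3 : (teichmuller p (g : F) ^ e - 1) * ∑ u : F, teichmuller p u ^ e = 0 := by
        rw [sub_mul, hS, one_mul, sub_self]
      exact (mul_eq_zero.1 h3).resolve_left hne
    rw [this]
    exact dvd_zero _

open Classical in
/-- A high power of a lift detects, modulo a power of `p`, whether an element vanishes. -/
lemma pow_dvd_indicator_sub [Fintype F] {f : ℕ} (hf : 0 < f) (hq : Fintype.card F = p ^ f)
    (E : WittVector p F) : (p : WittVector p F) ^ f ∣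
      (if constantCoeff E = 0 then 1 else 0) - (1 - E ^ (p ^ (f - 1) * (p ^ f - 1))) := by
  have hp1 := hp.out.one_lt
  have hq1 : 1 < p ^ f := Nat.one_lt_pow hf.ne' hp1
  split_ifs with h
  · rw [sub_sub_cancel]
    have h1 : f ≤ p ^ (f - 1) * (p ^ f - 1) := by
      have h2 : f - 1 < p ^ (f - 1) := Nat.lt_pow_self hp1
      have h3 : 1 ≤ p ^ f - 1 := by omega
      have h4 := Nat.le_mul_of_pos_right (p ^ (f - 1)) h3
      omega
    exact (pow_dvd_pow _ h1).trans (pow_dvd_pow_of_dvd (dvd_of_constantCoeff_eq_zero h) _)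
  · have h1 : (p : WittVector p F) ∣ E - teichmuller p (constantCoeff E) :=
      dvd_of_constantCoeff_eq_zero (by
        rw [map_sub, constantCoeff_apply (teichmuller p _), teichmuller_coeff_zero, sub_self])
    -- The factor p^(f-1) of the exponent upgrades a congruence modulo p to one modulo p^f; the
    -- factor p^f - 1 then kills the Teichmüller representative.
    have h2 := dvd_sub_pow_of_dvd_sub h1 (f - 1)
    rw [Nat.sub_add_cancel hf] at h2
    have h3 : (teichmuller p (constantCoeff E) ^ p ^ (f - 1)) ^ (p ^ f - 1) = 1 := by
      rw [← map_pow, ← map_pow, ← hq, FiniteField.pow_card_sub_one_eq_one _ (pow_ne_zero _ h),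
        map_one]
    rw [zero_sub, neg_sub, pow_mul, ← h3]
    exact h2.trans (sub_dvd_pow_sub_pow _ _ _)

end WittVector

/-! ### Comparing the zeros on u = 0 and u = 1. -/

section Counting

open WittVector

variable {p : ℕ} [hp : Fact p.Prime] {F : Type*} [Field F] [CharP F p]

/-- The value at the Teichmüller lift of `x` of the coefficientwise Teichmüller lift of `g`. -/
noncomputable def teichmullerEval (p : ℕ) [Fact p.Prime] {F : Type*} [Field F] [CharP F p]
    {σ : Type*} [Fintype σ] (g : MvPolynomial σ F) (x : σ → F) : WittVector p F :=
  ∑ w ∈ g.support, teichmuller p (g.coeff w) * ∏ v, teichmuller p (x v) ^ w v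

lemma constantCoeff_teichmullerEval {σ : Type*} [Fintype σ] (g : MvPolynomial σ F) (x : σ → F) :
    constantCoeff (teichmullerEval p g x) = MvPolynomial.eval x g := by
  have h : ∀ u : F, constantCoeff (teichmuller p u) = u := fun u => by
    rw [constantCoeff_apply, teichmuller_coeff_zero]
  simp only [teichmullerEval, map_sum, map_mul, map_prod, map_pow, h, MvPolynomial.eval_eq']

variable {ι τ : Type*} [Fintype ι] [Fintype τ] [DecidableEq ι] [DecidableEq τ]

/-- The point of `F^{1+τ}` with distinguished coordinate `u` and other coordinates `x`. -/
def consPoint (u : F) (x : τ → F) : Option τ → F := fun o => o.elim u x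

/-- The multinomial expansion, arranged by variables so that its sum over x factors coordinatewise.
-/
lemma prod_teichmullerEval_pow (g : ι → MvPolynomial (Option τ) F) (K : ℕ) (u : F) (x : τ → F) :
    ∏ l, teichmullerEval p (g l) (consPoint u x) ^ K =
      ∑ κ ∈ Fintype.piFinset fun l => (g l).support.piAntidiag K,
        ((∏ l, Nat.multinomial (g l).support (κ l) : ℕ) : WittVector p F) *
        (∏ l, ∏ w ∈ (g l).support, teichmuller p ((g l).coeff w) ^ κ l w) *
        (teichmuller p u ^ (∑ l, ∑ w ∈ (g l).support, κ l w * w none) *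
          ∏ v, teichmuller p (x v) ^ (∑ l, ∑ w ∈ (g l).support, κ l w * w (some v))) := by
  classical
  simp only [teichmullerEval, Finset.sum_pow_eq_sum_piAntidiag]
  rw [Finset.prod_univ_sum]
  refine Finset.sum_congr rfl fun κ _ => ?_
  rw [Finset.prod_mul_distrib, Nat.cast_prod, mul_assoc]
  congr 1
  have h : ∀ l, ∏ w ∈ (g l).support, (teichmuller p ((g l).coeff w) *
      ∏ v, teichmuller p (consPoint u x v) ^ w v) ^ κ l w =
      (∏ w ∈ (g l).support, teichmuller p ((g l).coeff w) ^ κ l w) *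
      ∏ v, teichmuller p (consPoint u x v) ^ (∑ w ∈ (g l).support, κ l w * w v) := fun l => by
    simp only [mul_pow, Finset.prod_mul_distrib, ← Finset.prod_pow_eq_pow_sum]
    congr 1
    rw [Finset.prod_comm]
    refine Finset.prod_congr rfl fun w _ => ?_
    rw [← Finset.prod_pow]
    exact Finset.prod_congr rfl fun v _ => by rw [← pow_mul, mul_comm]
  simp only [h, Finset.prod_mul_distrib]
  congr 1
  rw [Finset.prod_comm, Fintype.prod_option]
  simp only [Finset.prod_pow_eq_pow_sum, consPoint, Option.elim]

lemma dvd_sum_prod_sub [Fintype F] {f : ℕ} (hf : 0 < f) (hq : Fintype.card F = p ^ f)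
    (g : ι → MvPolynomial (Option τ) F) (hg : ∑ l, (g l).totalDegree ≤ Fintype.card τ) :
    (p : WittVector p F) ^ f ∣
      ∑ x : τ → F, ∏ l, teichmullerEval p (g l) (consPoint 0 x) ^ (p ^ (f - 1) * (p ^ f - 1)) -
      ∑ x : τ → F, ∏ l, teichmullerEval p (g l) (consPoint 1 x) ^ (p ^ (f - 1) * (p ^ f - 1)) := by
  classical
  simp only [prod_teichmullerEval_pow]
  rw [Finset.sum_comm, Finset.sum_comm (s := (Finset.univ : Finset (τ → F))),
    ← Finset.sum_sub_distrib]
  refine Finset.dvd_sum fun κ hκ => ?_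
  simp only [← Finset.mul_sum]
  have hprod : ∀ e : τ → ℕ, ∑ x : τ → F, ∏ v, teichmuller p (x v) ^ e v =
      ∏ v, ∑ u : F, teichmuller p u ^ e v := fun e => by
    rw [Finset.prod_univ_sum, Fintype.piFinset_univ]
  rw [hprod, ← mul_sub, ← sub_mul]
  set e0 := ∑ l, ∑ w ∈ (g l).support, κ l w * w none
  set e : τ → ℕ := fun v => ∑ l, ∑ w ∈ (g l).support, κ l w * w (some v) with he
  -- Monomials free of the distinguished coordinate agree at u = 0 and u = 1, so they cancel.
  by_cases h0 : e0 = 0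
  · simp [h0]
  by_cases hv : ∃ v, ¬ (0 < e v ∧ Fintype.card F - 1 ∣ e v)
  · obtain ⟨v, hv⟩ := hv
    have h1 := sum_teichmuller_pow (p := p) (e v) hv
    rw [hq] at h1
    push_cast at h1
    exact ((h1.trans (Finset.dvd_prod_of_mem (fun v => ∑ u : F, teichmuller p u ^ e v)
      (Finset.mem_univ v))).mul_left _).mul_left _
  · push Not at hv
    rw [hq] at hv
    have hκ' := Fintype.mem_piFinset.1 hκ
    have hM := pow_dvd_prod_multinomial p f hf (fun l => (g l).support)
      (fun l => (g l).totalDegree) (fun l w hw => by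
        have := MvPolynomial.le_totalDegree hw
        rwa [Finsupp.sum_fintype _ _ fun _ => rfl] at this)
      hg κ (fun l => (Finset.mem_piAntidiag.1 (hκ' l)).1) hv (Nat.pos_of_ne_zero h0)
    have hM' := Nat.cast_dvd_cast (α := WittVector p F) hM
    push_cast at hM' ⊢
    exact (hM'.mul_right _).mul_right _

-- Each indicator of a zero is replaced modulo p^f by 1 - E^K, and the resulting congruence in the
-- Witt vectors descends to the integers.
open Classical in
theorem card_zeros_modEq [Fintype F] (g : ι → MvPolynomial (Option τ) F)
    (hg : ∑ l, (g l).totalDegree ≤ Fintype.card τ) :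
    (Finset.univ.filter fun x : τ → F => ∀ l, MvPolynomial.eval (consPoint 0 x) (g l) = 0).card ≡
    (Finset.univ.filter fun x : τ → F => ∀ l, MvPolynomial.eval (consPoint 1 x) (g l) = 0).card
      [MOD Fintype.card F] := by
  obtain ⟨p, hpF⟩ := CharP.exists F
  have := hpF
  obtain ⟨⟨f, hf⟩, hprime, hq⟩ := FiniteField.card F p
  have : Fact p.Prime := ⟨hprime⟩
  simp only [PNat.mk_coe] at hq
  set K := p ^ (f - 1) * (p ^ f - 1) with hK
  have hcount : ∀ u : F, (p : WittVector p F) ^ f ∣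
      ((Finset.univ.filter fun x : τ → F =>
        ∀ l, MvPolynomial.eval (consPoint u x) (g l) = 0).card : WittVector p F) -
      ∑ x : τ → F, ∏ l, (1 - teichmullerEval p (g l) (consPoint u x) ^ K) := fun u => by
    rw [Finset.card_filter]
    push_cast
    rw [← Finset.sum_sub_distrib]
    refine Finset.dvd_sum fun x _ => ?_
    have h1 : (if ∀ l, MvPolynomial.eval (consPoint u x) (g l) = 0 then (1 : WittVector p F) else 0)
        = ∏ l, if MvPolynomial.eval (consPoint u x) (g l) = 0 then (1 : WittVector p F) else 0 := by
      rw [Finset.prod_ite_zero]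
      simp
    rw [h1]
    have hmod : ∀ l, (Ideal.Quotient.mk (Ideal.span {(p : WittVector p F) ^ f}))
        (if MvPolynomial.eval (consPoint u x) (g l) = 0 then (1 : WittVector p F) else 0) =
        Ideal.Quotient.mk _ (1 - teichmullerEval p (g l) (consPoint u x) ^ K) := fun l => by
      rw [Ideal.Quotient.eq, Ideal.mem_span_singleton, ← constantCoeff_teichmullerEval (p := p)]
      exact pow_dvd_indicator_sub hf hq _
    rw [← Ideal.mem_span_singleton, ← Ideal.Quotient.eq, map_prod, map_prod]
    exact Finset.prod_congr rfl fun l _ => hmod l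
  have hexp : (p : WittVector p F) ^ f ∣
      ∑ x : τ → F, ∏ l, (1 - teichmullerEval p (g l) (consPoint 0 x) ^ K) -
      ∑ x : τ → F, ∏ l, (1 - teichmullerEval p (g l) (consPoint 1 x) ^ K) := by
    -- Expanding over subsets of the equations leaves one power product per subfamily, whose degree
    -- sum still satisfies the bound.
    simp only [sub_eq_add_neg (1 : WittVector p F), Finset.prod_add, Finset.prod_const_one, one_mul]
    rw [Finset.sum_comm, Finset.sum_comm (s := (Finset.univ : Finset (τ → F))),
      ← Finset.sum_sub_distrib]
    refine Finset.dvd_sum fun I _ => ?_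
    simp only [Finset.prod_neg, ← Finset.mul_sum]
    rw [← mul_sub]
    refine Dvd.dvd.mul_left ?_ _
    have h2 := dvd_sum_prod_sub (p := p) hf hq (fun l : ↥(Finset.univ \ I) => g l) (by
      refine le_trans ?_ hg
      rw [Finset.sum_coe_sort (Finset.univ \ I) fun l => (g l).totalDegree]
      exact Finset.sum_le_sum_of_subset (Finset.subset_univ _))
    have h3 : ∀ u : F, ∀ x : τ → F,
        ∏ l : ↥(Finset.univ \ I), teichmullerEval p (g l) (consPoint u x) ^ K =
        ∏ l ∈ Finset.univ \ I, teichmullerEval p (g l) (consPoint u x) ^ K := fun u x =>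
      Finset.prod_coe_sort (Finset.univ \ I) fun l => teichmullerEval p (g l) (consPoint u x) ^ K
    simpa only [← hK, h3] using h2
  have htot := dvd_add (dvd_sub (hcount 0) (hcount 1)) hexp
  rw [Nat.ModEq.comm, Nat.modEq_iff_dvd, hq]
  push_cast
  refine pow_dvd_of_pow_dvd_intCast (p := p) (F := F) f _ ?_
  push_cast
  convert htot using 1
  ring

end Counting

/-! ### Transfer to parallel affine subspaces. -/

lemma totalDegree_aeval_le_of_linear {σ τ F : Type*} [CommSemiring F] (φ : σ → MvPolynomial τ F)
    (hφ : ∀ i, (φ i).totalDegree ≤ 1) (f : MvPolynomial σ F) :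
    (MvPolynomial.aeval φ f).totalDegree ≤ f.totalDegree := by
  rw [MvPolynomial.aeval_def, MvPolynomial.eval₂_eq]
  refine MvPolynomial.totalDegree_finsetSum_le fun w hw => ?_
  refine (MvPolynomial.totalDegree_mul _ _).trans ?_
  rw [MvPolynomial.algebraMap_eq, MvPolynomial.totalDegree_C, zero_add]
  refine (MvPolynomial.totalDegree_finsetProd _ _).trans ?_
  refine le_trans (Finset.sum_le_sum fun i _ => ?_) (MvPolynomial.le_totalDegree hw)
  exact (MvPolynomial.totalDegree_pow _ _).trans (by
    simpa using Nat.mul_le_mul_left (w i) (hφ i))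

open Classical in
/-- The number of points of `z` in the coset `a + D`. -/
noncomputable def cosetCount {F V : Type*} [Field F] [AddCommGroup V] [Module F V]
    (z : Finset V) (a : V) (D : Submodule F V) : ℕ :=
  (z.filter fun x => x - a ∈ D).card

open Classical in
/-- The zero set of `f` in the full affine space, as a finset. -/
noncomputable def zeroFinset {F : Type*} [Field F] [Fintype F] {n r : ℕ}
    (f : Fin r → MvPolynomial (Fin n) F) : Finset (Fin n → F) :=
  Finset.univ.filter fun x => ∀ i, MvPolynomial.eval x (f i) = 0

lemma mem_zeroFinset {F : Type*} [Field F] [Fintype F] {n r : ℕ}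
    (f : Fin r → MvPolynomial (Fin n) F) (x : Fin n → F) :
    x ∈ zeroFinset f ↔ ∀ i, MvPolynomial.eval x (f i) = 0 := by
  simp [zeroFinset]

/-- Parallel affine subspaces of large dimension contain congruent numbers of common zeros. -/
theorem cosetCount_zeroFinset_modEq {F : Type*} [Field F] [Fintype F] {n r : ℕ}
    (f : Fin r → MvPolynomial (Fin n) F) (D : Submodule F (Fin n → F))
    (hD : degreeSum f ≤ Module.finrank F D) (a b : Fin n → F) :
    cosetCount (zeroFinset f) a D ≡ cosetCount (zeroFinset f) b D [MOD Fintype.card F] := by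
  classical
  set m := Module.finrank F D
  let e := Module.finBasis F D
  -- The distinguished variable moves the base point from a (at 0) to b (at 1); the others run
  -- through D in a basis.
  let φ : Fin n → MvPolynomial (Option (Fin m)) F := fun i =>
    MvPolynomial.C (a i) + MvPolynomial.C (b i - a i) * MvPolynomial.X none +
      ∑ j, MvPolynomial.C ((e j : Fin n → F) i) * MvPolynomial.X (some j)
  have hCX : ∀ (c : F) (o : Option (Fin m)),
      (MvPolynomial.C c * MvPolynomial.X o : MvPolynomial (Option (Fin m)) F).totalDegree ≤ 1 :=
    fun c o => (MvPolynomial.totalDegree_mul _ _).trans (by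
      rw [MvPolynomial.totalDegree_C, MvPolynomial.totalDegree_X])
  have hφ : ∀ i, (φ i).totalDegree ≤ 1 := fun i => by
    refine (MvPolynomial.totalDegree_add _ _).trans (max_le ?_ ?_)
    · refine (MvPolynomial.totalDegree_add _ _).trans (max_le ?_ (hCX _ _))
      rw [MvPolynomial.totalDegree_C]
      exact zero_le_one
    · exact MvPolynomial.totalDegree_finsetSum_le fun j _ => hCX _ _
  have heval : ∀ (u : F) (x : Fin m → F) (l : Fin r),
      MvPolynomial.eval (consPoint u x) (MvPolynomial.aeval φ (f l)) =
      MvPolynomial.eval (a + u • (b - a) + (e.equivFun.symm x : Fin n → F)) (f l) :=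
    fun u x l => by
    have h1 : MvPolynomial.eval (consPoint u x) (MvPolynomial.aeval φ (f l)) =
        MvPolynomial.eval (fun i => MvPolynomial.eval (consPoint u x) (φ i)) (f l) := by
      rw [← MvPolynomial.bind₁, MvPolynomial.eval, MvPolynomial.eval₂Hom_bind₁]
      rfl
    rw [h1]
    congr 2
    funext i
    simp only [φ, map_add, map_mul, map_sum, MvPolynomial.eval_C, MvPolynomial.eval_X, consPoint,
      Option.elim, Module.Basis.equivFun_symm_apply, Pi.add_apply, Pi.smul_apply, Pi.sub_apply,
      Submodule.coe_sum, Submodule.coe_smul, Finset.sum_apply, smul_eq_mul]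
    rw [mul_comm u]
    simp only [mul_comm]
  have hcard : ∀ (u : F) (c : Fin n → F), a + u • (b - a) = c →
      (Finset.univ.filter fun x : Fin m → F =>
        ∀ l, MvPolynomial.eval (consPoint u x) (MvPolynomial.aeval φ (f l)) = 0).card =
      cosetCount (zeroFinset f) c D := fun u c hc => by
    simp only [heval, hc]
    refine Finset.card_bij (fun x _ => c + (e.equivFun.symm x : Fin n → F)) ?_ ?_ ?_
    · intro x hx
      rw [Finset.mem_filter] at hx
      rw [Finset.mem_filter, mem_zeroFinset]
      exact ⟨hx.2, by simp only [add_sub_cancel_left, SetLike.coe_mem]⟩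
    · intro x _ y _ h
      exact e.equivFun.symm.injective (Subtype.ext (add_left_cancel h))
    · intro y hy
      rw [Finset.mem_filter, mem_zeroFinset] at hy
      have h2 : c + (e.equivFun.symm (e.equivFun ⟨y - c, hy.2⟩) : Fin n → F) = y := by
        rw [LinearEquiv.symm_apply_apply]
        simp
      refine ⟨e.equivFun ⟨y - c, hy.2⟩, ?_, h2⟩
      rw [Finset.mem_filter]
      exact ⟨Finset.mem_univ _, by rw [h2]; exact hy.1⟩
  have hmain := card_zeros_modEq (F := F) (τ := Fin m) (fun l => MvPolynomial.aeval φ (f l)) (by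
    rw [Fintype.card_fin]
    exact (Finset.sum_le_sum fun l _ => totalDegree_aeval_le_of_linear φ hφ (f l)).trans hD)
  rw [← hcard 0 a (by simp), ← hcard 1 b (by simp)]
  convert hmain

/-! ### Hyperplanes and one-dimensional extensions of subspaces. -/

section Subspaces

variable {F V : Type*} [Field F] [AddCommGroup V] [Module F V]

lemma exists_linearMap_apply_eq_one {v : V} (hv : v ≠ 0) : ∃ φ : V →ₗ[F] F, φ v = 1 := by
  obtain ⟨g, hg, -⟩ := Submodule.exists_le_ker_of_notMem (K := F) (p := ⊥) (v := v) (by simpa)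
  exact ⟨(g v)⁻¹ • g, by simp [hg]⟩

lemma inf_ker_sup_span_singleton {D : Submodule F V} {v : V} (hv : v ∈ D) {φ : V →ₗ[F] F}
    (hφ : φ v = 1) : (D ⊓ LinearMap.ker φ) ⊔ Submodule.span F {v} = D := by
  refine le_antisymm (sup_le inf_le_left ((Submodule.span_singleton_le_iff_mem _ _).2 hv)) ?_
  intro x hx
  refine Submodule.mem_sup.2 ⟨x - φ x • v, ⟨D.sub_mem hx (D.smul_mem _ hv), ?_⟩, φ x • v,
    Submodule.smul_mem _ _ (Submodule.mem_span_singleton_self v), by simp⟩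
  simp [hφ]

lemma finrank_inf_ker [FiniteDimensional F V] {D : Submodule F V} {v : V} (hv : v ∈ D)
    {φ : V →ₗ[F] F} (hφ : φ v = 1) :
    Module.finrank F ↥(D ⊓ LinearMap.ker φ) + 1 = Module.finrank F D := by
  have h : v ∉ D ⊓ LinearMap.ker φ := fun h => by
    have : φ v = 0 := h.2
    rw [hφ] at this
    exact one_ne_zero this
  rw [← Submodule.finrank_sup_span_singleton h, inf_ker_sup_span_singleton hv hφ]

lemma mem_sup_span_singleton_iff {D : Submodule F V} {x y : V} :
    x ∈ D ⊔ Submodule.span F {y} ↔ ∃ t : F, x - t • y ∈ D := by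
  constructor
  · intro h
    obtain ⟨u, hu, w, hw, rfl⟩ := Submodule.mem_sup.1 h
    obtain ⟨t, rfl⟩ := Submodule.mem_span_singleton.1 hw
    exact ⟨t, by simpa⟩
  · rintro ⟨t, ht⟩
    exact Submodule.mem_sup.2 ⟨_, ht, t • y, Submodule.smul_mem _ _
      (Submodule.mem_span_singleton_self y), by simp⟩

lemma mem_sup_span_singleton_self (D : Submodule F V) (y : V) : y ∈ D ⊔ Submodule.span F {y} :=
  Submodule.mem_sup_right (Submodule.mem_span_singleton_self y)

lemma mem_sup_span_singleton_exchange {D : Submodule F V} {x y : V}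
    (h : x ∈ D ⊔ Submodule.span F {y}) (hx : x ∉ D) : y ∈ D ⊔ Submodule.span F {x} := by
  obtain ⟨t, ht⟩ := mem_sup_span_singleton_iff.1 h
  have ht0 : t ≠ 0 := by
    rintro rfl
    exact hx (by simpa using ht)
  refine mem_sup_span_singleton_iff.2 ⟨t⁻¹, ?_⟩
  have := D.smul_mem (-t⁻¹) ht
  rwa [smul_sub, smul_smul, neg_mul, inv_mul_cancel₀ ht0, neg_smul, neg_smul, one_smul,
    sub_neg_eq_add, neg_add_eq_sub] at this

lemma sup_span_singleton_inf {U D : Submodule F V} (hU : U ≤ D) {v : V} (hv : v ∉ D) :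
    (U ⊔ Submodule.span F {v}) ⊓ D = U := by
  refine le_antisymm ?_ (le_inf le_sup_left hU)
  rintro x ⟨hx, hxD⟩
  obtain ⟨t, ht⟩ := mem_sup_span_singleton_iff.1 hx
  by_cases h0 : t = 0
  · simpa [h0] using ht
  · exfalso
    have h1 : t • v ∈ D := by
      have := D.sub_mem hxD (hU ht)
      rwa [sub_sub_cancel] at this
    exact hv ((D.smul_mem_iff h0).1 h1)

end Subspaces

/-! ### Counting points in cosets. -/

section CosetCount

variable {F V : Type*} [Field F] [AddCommGroup V] [Module F V]

lemma cosetCount_mono {z : Finset V} {a : V} {D E : Submodule F V} (h : D ≤ E) :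
    cosetCount z a D ≤ cosetCount z a E := by
  classical
  exact Finset.card_le_card (Finset.monotone_filter_right _ fun _ _ hx => h hx)

lemma cosetCount_top (z : Finset V) (a : V) : cosetCount z a (⊤ : Submodule F V) = z.card := by
  simp [cosetCount]

lemma cosetCount_congr {z : Finset V} {a b : V} {D : Submodule F V} (h : a - b ∈ D) :
    cosetCount z a D = cosetCount z b D := by
  classical
  unfold cosetCount
  congr 1
  refine Finset.filter_congr fun x _ => ?_
  rw [← D.add_mem_iff_left h, sub_add_sub_cancel]

variable [Fintype F]

open Classical in
lemma card_filter_mem_submodule [Fintype V] (D : Submodule F V) :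
    (Finset.univ.filter fun x => x ∈ D).card = Fintype.card F ^ Module.finrank F D := by
  rw [← Module.card_eq_pow_finrank (K := F) (V := D), Fintype.card_subtype]

open Classical in
lemma card_filter_sub_mem [Fintype V] (D : Submodule F V) (a : V) :
    (Finset.univ.filter fun x => x - a ∈ D).card = Fintype.card F ^ Module.finrank F D := by
  rw [← card_filter_mem_submodule]
  exact Finset.card_bij (fun x _ => x - a) (by simp) (by simp) fun y hy =>
    ⟨y + a, by simpa using hy, by simp⟩

open Classical in
lemma card_filter_sub_mem' [Fintype V] (D : Submodule F V) (x : V) :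
    (Finset.univ.filter fun a => x - a ∈ D).card = Fintype.card F ^ Module.finrank F D := by
  rw [← card_filter_sub_mem D x]
  congr 1
  exact Finset.filter_congr fun a _ => by rw [← neg_sub, D.neg_mem_iff]

lemma sum_cosetCount [Fintype V] (z : Finset V) (D : Submodule F V) :
    ∑ b, cosetCount z b D = z.card * Fintype.card F ^ Module.finrank F D := by
  classical
  have h := Finset.sum_card_bipartiteAbove_eq_sum_card_bipartiteBelow (s := (Finset.univ : Finset V))
    (t := z) (fun b x => x - b ∈ D)
  simp only [Finset.bipartiteAbove, Finset.bipartiteBelow, card_filter_sub_mem',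
    Finset.sum_const, smul_eq_mul] at h
  exact h

lemma pow_finrank_sub_mul [Fintype V] (D : Submodule F V) :
    Fintype.card F ^ (Module.finrank F V - Module.finrank F D) *
      Fintype.card F ^ Module.finrank F D = Fintype.card V := by
  rw [← pow_add, Nat.sub_add_cancel (Submodule.finrank_le D), ← Module.card_eq_pow_finrank]

/-- Averaging over all translates of D. -/
lemma mul_pow_le_card [Fintype V] {z : Finset V} {D : Submodule F V} {c : ℕ}
    (h : ∀ b, c ≤ cosetCount z b D) :
    c * Fintype.card F ^ (Module.finrank F V - Module.finrank F D) ≤ z.card := by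
  have h1 := Finset.sum_le_sum fun b (_ : b ∈ Finset.univ) => h b
  rw [sum_cosetCount, Finset.sum_const, Finset.card_univ, smul_eq_mul, ← pow_finrank_sub_mul D,
    mul_comm _ c, ← mul_assoc] at h1
  exact Nat.le_of_mul_le_mul_right h1 (pow_pos Fintype.card_pos _)

lemma mul_pow_lt_card [Fintype V] {z : Finset V} {D : Submodule F V} {c : ℕ}
    (h : ∀ b, c ≤ cosetCount z b D) {a : V} (ha : c < cosetCount z a D) :
    c * Fintype.card F ^ (Module.finrank F V - Module.finrank F D) < z.card := by
  have h1 := Finset.sum_lt_sum (fun b (_ : b ∈ Finset.univ) => h b) ⟨a, Finset.mem_univ a, ha⟩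
  rw [sum_cosetCount, Finset.sum_const, Finset.card_univ, smul_eq_mul, ← pow_finrank_sub_mul D,
    mul_comm _ c, ← mul_assoc] at h1
  exact Nat.lt_of_mul_lt_mul_right h1

/-- If each one-dimensional extension of `D` in `E` acquires at least `c` new points, then so many
points of `E` must exist. -/
lemma mul_pow_sub_one_le_of_extensions [Fintype V] {z : Finset V} {a : V} {D E : Submodule F V}
    (hDE : D ≤ E) {c : ℕ} (h : ∀ y ∈ E, y ∉ D →
      c + cosetCount z a D ≤ cosetCount z a (D ⊔ Submodule.span F {y})) :
    c * (Fintype.card F ^ (Module.finrank F E - Module.finrank F D) - 1) +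
      cosetCount z a D * (Fintype.card F - 1) ≤ cosetCount z a E * (Fintype.card F - 1) := by
  classical
  set q := Fintype.card F with hq
  set k := Module.finrank F D with hk
  have hq0 : 0 < q := Fintype.card_pos
  have hnew : ∀ E' : Submodule F V, D ≤ E' →
      (z.filter fun x => x - a ∈ E' ∧ x - a ∉ D).card + cosetCount z a D = cosetCount z a E' :=
    fun E' hE' => by
    have h1 := Finset.card_filter_add_card_filter_not (s := z.filter fun x => x - a ∈ E')
      (fun x => x - a ∈ D)
    rw [Finset.filter_filter, Finset.filter_filter] at h1
    have h2 : (z.filter fun x => x - a ∈ E' ∧ x - a ∈ D) = z.filter fun x => x - a ∈ D :=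
      Finset.filter_congr fun x _ => ⟨fun hx => hx.2, fun hx => ⟨hE' hx, hx⟩⟩
    rw [h2] at h1
    unfold cosetCount
    omega
  have hdiff : ∀ E' : Submodule F V, D ≤ E' →
      (Finset.univ.filter fun y => y ∈ E' ∧ y ∉ D).card + q ^ k = q ^ Module.finrank F E' :=
    fun E' hE' => by
    have h1 := Finset.card_filter_add_card_filter_not
      (s := (Finset.univ : Finset V).filter fun x => x ∈ E') (fun x => x ∈ D)
    rw [Finset.filter_filter, Finset.filter_filter, card_filter_mem_submodule] at h1
    have h2 : ((Finset.univ : Finset V).filter fun x => x ∈ E' ∧ x ∈ D) =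
        Finset.univ.filter fun x => x ∈ D :=
      Finset.filter_congr fun x _ => ⟨fun hx => hx.2, fun hx => ⟨hE' hx, hx⟩⟩
    rw [h2, card_filter_mem_submodule, ← hq, ← hk] at h1
    omega
  -- Count pairs (y, x) with x a new point in the extension by y. By exchange, a given x is paired
  -- only with y in D + ⟨x - a⟩ outside D, that is, with at most q^(k+1) - q^k vectors.
  have hdc := Finset.sum_card_bipartiteAbove_eq_sum_card_bipartiteBelow
    (s := Finset.univ.filter fun y => y ∈ E ∧ y ∉ D)
    (t := z.filter fun x => x - a ∈ E ∧ x - a ∉ D)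
    (fun y x => x - a ∈ D ⊔ Submodule.span F {y})
  have hlow : (Finset.univ.filter fun y => y ∈ E ∧ y ∉ D).card * c ≤
      ∑ y ∈ Finset.univ.filter fun y => y ∈ E ∧ y ∉ D,
        (Finset.bipartiteAbove (fun y x => x - a ∈ D ⊔ Submodule.span F {y})
          (z.filter fun x => x - a ∈ E ∧ x - a ∉ D) y).card := by
    rw [← smul_eq_mul]
    refine Finset.card_nsmul_le_sum _ _ _ fun y hy => ?_
    obtain ⟨-, hyE, hyD⟩ := Finset.mem_filter.1 hy
    have h1 := h y hyE hyD
    have h2 := hnew (D ⊔ Submodule.span F {y}) le_sup_left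
    have h3 : (z.filter fun x => x - a ∈ D ⊔ Submodule.span F {y} ∧ x - a ∉ D).card ≤
        (Finset.bipartiteAbove (fun y x => x - a ∈ D ⊔ Submodule.span F {y})
          (z.filter fun x => x - a ∈ E ∧ x - a ∉ D) y).card := by
      refine Finset.card_le_card fun x hx => ?_
      obtain ⟨hxz, hx1, hx2⟩ := Finset.mem_filter.1 hx
      rw [Finset.bipartiteAbove, Finset.mem_filter, Finset.mem_filter]
      exact ⟨⟨hxz, (sup_le hDE ((Submodule.span_singleton_le_iff_mem _ _).2 hyE)) hx1, hx2⟩, hx1⟩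
    omega
  have hup : ∑ x ∈ z.filter fun x => x - a ∈ E ∧ x - a ∉ D,
        (Finset.bipartiteBelow (fun y x => x - a ∈ D ⊔ Submodule.span F {y})
          (Finset.univ.filter fun y => y ∈ E ∧ y ∉ D) x).card ≤
      (z.filter fun x => x - a ∈ E ∧ x - a ∉ D).card * (q ^ (k + 1) - q ^ k) := by
    rw [← smul_eq_mul]
    refine Finset.sum_le_card_nsmul _ _ _ fun x hx => ?_
    obtain ⟨-, hxE, hxD⟩ := Finset.mem_filter.1 hx
    have h1 := hdiff (D ⊔ Submodule.span F {x - a}) le_sup_left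
    rw [Submodule.finrank_sup_span_singleton hxD, ← hk] at h1
    refine le_trans (Finset.card_le_card (t := Finset.univ.filter fun y =>
      y ∈ D ⊔ Submodule.span F {x - a} ∧ y ∉ D) fun y hy => ?_) (by omega)
    rw [Finset.bipartiteBelow, Finset.mem_filter, Finset.mem_filter] at hy
    rw [Finset.mem_filter]
    exact ⟨Finset.mem_univ _, mem_sup_span_singleton_exchange hy.2 hxD, hy.1.2.2⟩
  have hE := hnew E hDE
  have hdE := hdiff E hDE
  have hke : k ≤ Module.finrank F E := Submodule.finrank_mono hDE
  have hpow : q ^ Module.finrank F E = q ^ k * q ^ (Module.finrank F E - k) := by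
    rw [← pow_add, Nat.add_sub_cancel' hke]
  have h1 : (Finset.univ.filter fun y => y ∈ E ∧ y ∉ D).card =
      q ^ k * (q ^ (Module.finrank F E - k) - 1) := by
    rw [Nat.mul_sub, mul_one, ← hpow]
    omega
  have h2 : q ^ (k + 1) - q ^ k = q ^ k * (q - 1) := by rw [Nat.mul_sub, mul_one, pow_succ]
  have h3 := (hlow.trans_eq hdc).trans hup
  rw [h1, h2, mul_assoc, mul_left_comm _ (q ^ k)] at h3
  have h4 := Nat.le_of_mul_le_mul_left h3 (pow_pos hq0 k)
  rw [← hE, add_mul]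
  rw [mul_comm c]
  exact Nat.add_le_add_right h4 _

/-- Parallel cosets of subspaces of dimension at least `d` meet `z` in congruent numbers of
points. -/
def ParallelCongruent (F : Type*) {V : Type*} [Field F] [AddCommGroup V] [Module F V] [Fintype F]
    (z : Finset V) (d : ℕ) : Prop :=
  ∀ (D : Submodule F V) (a b : V), d ≤ Module.finrank F D →
    cosetCount z a D ≡ cosetCount z b D [MOD Fintype.card F]

/-- The coset splits into q parallel cosets of a hyperplane of D, still of dimension at least d,
whose counts are all congruent modulo q. -/
lemma ParallelCongruent.card_dvd [FiniteDimensional F V] {z : Finset V} {d : ℕ}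
    (H : ParallelCongruent F z d) {D : Submodule F V} (hD : d < Module.finrank F D) (a : V) :
    Fintype.card F ∣ cosetCount z a D := by
  classical
  have hne : D ≠ ⊥ := by
    rintro rfl
    simp at hD
  obtain ⟨v, hv, hv0⟩ := Submodule.exists_mem_ne_zero_of_ne_bot hne
  obtain ⟨φ, hφ⟩ := exists_linearMap_apply_eq_one (F := F) hv0
  have hfin := finrank_inf_ker hv hφ
  have hfib : cosetCount z a D = ∑ t : F, cosetCount z (a + t • v) (D ⊓ LinearMap.ker φ) := by
    rw [cosetCount, Finset.card_eq_sum_card_fiberwise (f := fun x => φ (x - a)) (t := Finset.univ)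
      (fun _ _ => Finset.mem_coe.2 (Finset.mem_univ _))]
    refine Finset.sum_congr rfl fun t _ => ?_
    rw [Finset.filter_filter, cosetCount]
    congr 1
    refine Finset.filter_congr fun x _ => ?_
    rw [← sub_sub, Submodule.mem_inf, LinearMap.mem_ker, map_sub φ (x - a), map_smul, hφ,
      smul_eq_mul, mul_one, sub_eq_zero, sub_eq_add_neg (x - a),
      D.add_mem_iff_left (D.neg_mem (D.smul_mem t hv))]
  rw [hfib, ← Nat.modEq_zero_iff_dvd]
  have h1 : ∑ t : F, cosetCount z (a + t • v) (D ⊓ LinearMap.ker φ) ≡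
      ∑ _t : F, cosetCount z a (D ⊓ LinearMap.ker φ) [MOD Fintype.card F] :=
    Nat.ModEq.sum fun t _ => H _ _ _ (by omega)
  refine h1.trans ((Nat.modEq_zero_iff_dvd).2 ?_)
  rw [Finset.sum_const, smul_eq_mul, Finset.card_univ]
  exact dvd_mul_right _ _

end CosetCount

/-- Either a property propagates from `k₀` up to `d`, or there is a last place where it holds. -/
lemma exists_last_or {P : ℕ → Prop} {k₀ d : ℕ} (h0 : P k₀) (hk : k₀ ≤ d) :
    P d ∨ ∃ k, k₀ ≤ k ∧ k < d ∧ P k ∧ ¬ P (k + 1) := by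
  by_contra! h
  exact h.1 (Nat.le_induction (P := fun m _ => m ≤ d → P m) (fun _ => h0)
    (fun m hm ih hmd => h.2 m hm (by omega) (ih (by omega))) d hk le_rfl)

/-! ### Bounds (i) and (ii) for sets that are not affine. -/

section LowerBounds

variable {F V : Type*} [Field F] [AddCommGroup V] [Module F V]

lemma two_le_cosetCount {z : Finset V} {a x y : V} {D : Submodule F V} (hx : x ∈ z) (hy : y ∈ z)
    (hxy : x ≠ y) (hxD : x - a ∈ D) (hyD : y - a ∈ D) : 2 ≤ cosetCount z a D := by
  classical
  refine Finset.one_lt_card.2 ⟨x, ?_, y, ?_, hxy⟩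
  · simp [hx, hxD]
  · simp [hy, hyD]

lemma three_le_cosetCount {z : Finset V} {a x y w : V} {D : Submodule F V} (hx : x ∈ z)
    (hy : y ∈ z) (hw : w ∈ z) (hxy : x ≠ y) (hxw : x ≠ w) (hyw : y ≠ w) (hxD : x - a ∈ D)
    (hyD : y - a ∈ D) (hwD : w - a ∈ D) : 3 ≤ cosetCount z a D := by
  classical
  refine Finset.two_lt_card.2 ⟨x, ?_, y, ?_, w, ?_, hxy, hxw, hyw⟩
  · simp [hx, hxD]
  · simp [hy, hyD]
  · simp [hw, hwD]

variable [Fintype F] [Fintype V]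

lemma cosetCount_lt_of_notMem {z : Finset V} {a x : V} {D : Submodule F V} (hx : x - a ∈ D)
    (hxz : x ∉ z) : cosetCount z a D < Fintype.card F ^ Module.finrank F D := by
  classical
  rw [← card_filter_sub_mem D a]
  refine Finset.card_lt_card (Finset.ssubset_iff_of_subset
    (Finset.filter_subset_filter _ (Finset.subset_univ _)) |>.2 ⟨x, ?_, ?_⟩)
  · simpa using hx
  · simp [hxz]

/-- A set which is not an affine subspace has a line through two of its points that it does not
contain, when the field has more than two elements. -/
lemma exists_line {z : Finset V} (hz : ¬ ∃ A : AffineSubspace F V, (A : Set V) = z)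
    (hq : 3 ≤ Fintype.card F) : ∃ (D : Submodule F V) (a : V), Module.finrank F D = 1 ∧
      2 ≤ cosetCount z a D ∧ cosetCount z a D < Fintype.card F := by
  classical
  have h : ∃ p₁ ∈ z, ∃ p₂ ∈ z, ∃ c : F, p₂ + c • (p₁ - p₂) ∉ z := by
    by_contra! hcon
    refine hz ⟨⟨z, fun c p₁ p₂ p₃ h1 h2 h3 => ?_⟩, rfl⟩
    -- With l different from 0 and 1, the point c(p₁ - p₂) + p₃ lies on a line joining a point of
    -- the line p₁p₂ to a point of the line p₂p₃.
    obtain ⟨l, hl0, hl1⟩ : ∃ l : F, l ≠ 0 ∧ 1 - l ≠ 0 := by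
      by_contra! hl
      have : (Finset.univ : Finset F) ⊆ {0, 1} := fun x _ => by
        by_cases hx : x = 0
        · simp [hx]
        · have := sub_eq_zero.1 (hl x hx)
          simp [← this]
      have := (Finset.card_le_card this).trans Finset.card_le_two
      rw [Finset.card_univ] at this
      omega
    have hA := hcon p₁ h1 p₂ h2 (c / l)
    have hB := hcon p₃ h3 p₂ h2 (1 / (1 - l))
    have hC := hcon _ hA _ hB l
    have : p₂ + (1 / (1 - l)) • (p₃ - p₂) + l • (p₂ + (c / l) • (p₁ - p₂) -
        (p₂ + (1 / (1 - l)) • (p₃ - p₂))) = c • (p₁ -ᵥ p₂) +ᵥ p₃ := by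
      rw [vsub_eq_sub, vadd_eq_add]
      have e1 : l * (c / l) = c := by field_simp
      have e2 : (1 - l) * (1 / (1 - l)) = 1 := by field_simp
      calc _ = p₂ + (l * (c / l)) • (p₁ - p₂) + ((1 - l) * (1 / (1 - l))) • (p₃ - p₂) := by module
        _ = _ := by rw [e1, e2]; module
    rwa [this] at hC
  obtain ⟨p₁, h1, p₂, h2, c, hc⟩ := h
  have hne : p₁ ≠ p₂ := by
    rintro rfl
    simp [h1] at hc
  have hfin : Module.finrank F (Submodule.span F {p₁ - p₂}) = 1 :=
    finrank_span_singleton (sub_ne_zero.2 hne)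
  refine ⟨Submodule.span F {p₁ - p₂}, p₂, hfin, ?_, ?_⟩
  · exact two_le_cosetCount h1 h2 hne (Submodule.mem_span_singleton_self _) (by simp)
  · have := cosetCount_lt_of_notMem (z := z) (a := p₂) (x := p₂ + c • (p₁ - p₂))
      (D := Submodule.span F {p₁ - p₂}) (by
        rw [add_sub_cancel_left]
        exact Submodule.smul_mem _ _ (Submodule.mem_span_singleton_self _)) hc
    rwa [hfin, pow_one] at this

/-- Over two elements a line has only two points, so lines detect nothing. Instead three points of z
whose fourth parallelogram vertex is missing span a four-point plane. -/
lemma exists_plane {z : Finset V} (hz : ¬ ∃ A : AffineSubspace F V, (A : Set V) = z)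
    (hq : Fintype.card F = 2) : ∃ (D : Submodule F V) (a : V), Module.finrank F D = 2 ∧
      cosetCount z a D = 3 := by
  classical
  have h01 : ∀ c : F, c = 0 ∨ c = 1 := fun c => by
    by_contra! hc
    have : ({0, 1, c} : Finset F).card = 3 := Finset.card_eq_three.2
      ⟨0, 1, c, zero_ne_one, hc.1.symm, hc.2.symm, rfl⟩
    have := this.symm.le.trans (Finset.card_le_univ _)
    omega
  have h2 : ∀ x : V, x + x = 0 := fun x => by
    rcases h01 (1 + 1) with h | h
    · rw [← one_smul F x, ← add_smul, h, zero_smul]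
    · simp at h
  have h : ∃ p₁ ∈ z, ∃ p₂ ∈ z, ∃ p₃ ∈ z, p₁ - p₂ + p₃ ∉ z := by
    by_contra! hcon
    refine hz ⟨⟨z, fun c p₁ p₂ p₃ h1 h2 h3 => ?_⟩, rfl⟩
    rcases h01 c with rfl | rfl
    · simpa using h3
    · simpa using hcon p₁ h1 p₂ h2 p₃ h3
  obtain ⟨p₁, h1, p₂, hp2, p₃, h3, hout⟩ := h
  have hne12 : p₁ ≠ p₂ := by
    rintro rfl
    simp [h3] at hout
  have hne32 : p₃ ≠ p₂ := by
    rintro rfl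
    simp [h1] at hout
  have hne13 : p₁ ≠ p₃ := by
    rintro rfl
    apply hout
    have : p₁ - p₂ + p₁ = p₂ := by
      rw [sub_add_eq_add_sub, h2, zero_sub, neg_eq_iff_add_eq_zero, h2]
    rwa [this]
  set L := Submodule.span F {p₁ - p₂} with hL
  have hLfin : Module.finrank F L = 1 := finrank_span_singleton (sub_ne_zero.2 hne12)
  have hnot : p₃ - p₂ ∉ L := fun hmem => by
    obtain ⟨c, hc⟩ := Submodule.mem_span_singleton.1 hmem
    rcases h01 c with rfl | rfl
    · exact hne32 (sub_eq_zero.1 (by simpa using hc.symm))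
    · exact hne13 (by simpa using hc)
  have hfin := Submodule.finrank_sup_span_singleton hnot
  rw [hLfin] at hfin
  have m1 : p₁ - p₂ ∈ L ⊔ Submodule.span F {p₃ - p₂} :=
    Submodule.mem_sup_left (Submodule.mem_span_singleton_self _)
  have m3 : p₃ - p₂ ∈ L ⊔ Submodule.span F {p₃ - p₂} := mem_sup_span_singleton_self _ _
  refine ⟨_, p₂, hfin, le_antisymm ?_ ?_⟩
  · have := cosetCount_lt_of_notMem (z := z) (a := p₂) (x := p₁ - p₂ + p₃)
      (D := L ⊔ Submodule.span F {p₃ - p₂}) (by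
        rw [add_sub_assoc]
        exact Submodule.add_mem _ m1 m3) hout
    rw [hfin, hq] at this
    omega
  · exact three_le_cosetCount h1 hp2 h3 hne12 hne13 hne32.symm m1 (by simp) m3

lemma sub_one_mul_pow_le {q n d k : ℕ} (hq : 0 < q) (hdn : d < n) (hk : k < d) :
    (q - 1) * q ^ (n - d) ≤ q ^ (n - k) - 1 := by
  have h1 : q ^ (n - d + 1) ≤ q ^ (n - k) := Nat.pow_le_pow_right hq (by omega)
  have h2 : 1 ≤ q ^ (n - d) := Nat.one_le_pow _ _ hq
  rw [pow_succ, mul_comm] at h1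
  rw [Nat.sub_mul, one_mul]
  omega

/-- Since dim D < d, the ratio (q^(n - dim D) - 1) / (q - 1) from the double count is at least
q^(n-d). -/
lemma add_mul_pow_le_card {z : Finset V} {a : V} {D : Submodule F V} {d c : ℕ}
    (hdn : d < Module.finrank F V) (hD : Module.finrank F D < d)
    (h : ∀ y, y ∉ D → c + cosetCount z a D ≤ cosetCount z a (D ⊔ Submodule.span F {y})) :
    cosetCount z a D + c * Fintype.card F ^ (Module.finrank F V - d) ≤ z.card := by
  have h1 := mul_pow_sub_one_le_of_extensions (E := ⊤) le_top fun y _ hy => h y hy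
  rw [cosetCount_top, finrank_top] at h1
  have hq : 1 < Fintype.card F := Fintype.one_lt_card
  have h2 := Nat.mul_le_mul_left c (sub_one_mul_pow_le (q := Fintype.card F) (by omega) hdn hD)
  refine Nat.le_of_mul_le_mul_right (c := Fintype.card F - 1) ?_ (by omega)
  calc _ = c * ((Fintype.card F - 1) * Fintype.card F ^ (Module.finrank F V - d)) +
        cosetCount z a D * (Fintype.card F - 1) := by ring
    _ ≤ _ := (Nat.add_le_add_right h2 _).trans h1

theorem pow_lt_card_of_not_affine {z : Finset V} {d : ℕ} (H : ParallelCongruent F z d)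
    (hdn : d < Module.finrank F V) (hz : ¬ ∃ A : AffineSubspace F V, (A : Set V) = z) :
    Fintype.card F ^ (Module.finrank F V - d) < z.card := by
  -- At dimension d a nonzero residue makes every parallel coset nonempty, and the bound 2 gives
  -- strictness. If P fails at k + 1, all extensions have counts divisible by q and so gain a point.
  let P : ℕ → Prop := fun k => ∃ (D : Submodule F V) (a : V), Module.finrank F D = k ∧
    2 ≤ cosetCount z a D ∧ ¬ Fintype.card F ∣ cosetCount z a D
  have hq1 : 1 < Fintype.card F := Fintype.one_lt_card
  have hP : ∃ k, P k := by
    rcases Nat.lt_or_ge 2 (Fintype.card F) with hq | hq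
    · obtain ⟨D, a, h1, h2, h3⟩ := exists_line hz hq
      exact ⟨1, D, a, h1, h2, Nat.not_dvd_of_pos_of_lt (by omega) h3⟩
    · have hq2 : Fintype.card F = 2 := by omega
      obtain ⟨D, a, h1, h2⟩ := exists_plane hz hq2
      exact ⟨2, D, a, h1, by omega, by rw [hq2, h2]; decide⟩
  obtain ⟨k₀, hk₀⟩ := hP
  have hle : k₀ ≤ d := by
    obtain ⟨D, a, h1, -, h3⟩ := hk₀
    by_contra! hlt
    exact h3 (H.card_dvd (by omega) a)
  rcases exists_last_or hk₀ hle with ⟨D, a, h1, h2, h3⟩ | ⟨k, -, hkd, ⟨D, a, h1, h2, h3⟩, hnot⟩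
  · have hone : ∀ b, 1 ≤ cosetCount z b D := fun b => by
      by_contra! hb
      have h4 := H D a b h1.ge
      rw [show cosetCount z b D = 0 by omega, Nat.modEq_zero_iff_dvd] at h4
      exact h3 h4
    have := mul_pow_lt_card hone (a := a) (by omega)
    rwa [h1, one_mul] at this
  · have := add_mul_pow_le_card (z := z) (a := a) (D := D) (c := 1) hdn (by omega) fun y hy => by
      have h4 : cosetCount z a D ≤ cosetCount z a (D ⊔ Submodule.span F {y}) :=
        cosetCount_mono le_sup_left
      have h5 : Fintype.card F ∣ cosetCount z a (D ⊔ Submodule.span F {y}) := by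
        by_contra h6
        exact hnot ⟨_, a, by rw [Submodule.finrank_sup_span_singleton hy, h1], by omega, h6⟩
      have h7 : cosetCount z a D ≠ cosetCount z a (D ⊔ Submodule.span F {y}) := fun h8 =>
        h3 (h8 ▸ h5)
      omega
    omega

/-- This is the one case where an extension gains just one point R. Tilting the section about a
hyperplane U of D gives W meeting D in U, so W has at most the points of U and R. -/
lemma exists_smaller_section {z : Finset V} (hq : 4 ≤ Fintype.card F) {D : Submodule F V} {a y : V}
    (hD : cosetCount z a D + 1 = Fintype.card F)
    (hDy : cosetCount z a (D ⊔ Submodule.span F {y}) = Fintype.card F) :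
    ∃ (W : Submodule F V) (b : V), Module.finrank F W = Module.finrank F D ∧
      2 ≤ cosetCount z b W ∧ cosetCount z b W + 2 ≤ Fintype.card F := by
  classical
  obtain ⟨P, hP, Q, hQ, hPQ⟩ := Finset.one_lt_card.1
    (show 1 < (z.filter fun x => x - a ∈ D).card by unfold cosetCount at hD; omega)
  rw [Finset.mem_filter] at hP hQ
  set D' := D ⊔ Submodule.span F {y} with hD'
  have hsub : (z.filter fun x => x - a ∈ D) ⊆ z.filter fun x => x - a ∈ D' :=
    Finset.monotone_filter_right _ fun _ _ hx => Submodule.mem_sup_left hx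
  obtain ⟨R, hR, hRD⟩ := Finset.exists_mem_notMem_of_card_lt_card
    (show (z.filter fun x => x - a ∈ D).card < (z.filter fun x => x - a ∈ D').card by
      unfold cosetCount at hD hDy; omega)
  have hall : insert R (z.filter fun x => x - a ∈ D) = z.filter fun x => x - a ∈ D' :=
    Finset.eq_of_subset_of_card_le (Finset.insert_subset hR hsub) (by
      rw [Finset.card_insert_of_notMem hRD]
      unfold cosetCount at hD hDy; omega)
  rw [Finset.mem_filter] at hR
  replace hRD : R - a ∉ D := fun h => hRD (Finset.mem_filter.2 ⟨hR.1, h⟩)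
  have hRPD : R - P ∉ D := fun h => hRD (by simpa using D.add_mem h hP.2)
  have hQPD : Q - P ∈ D := by simpa using D.sub_mem hQ.2 hP.2
  have hRPD' : R - P ∈ D' := by
    simpa using D'.sub_mem hR.2 (Submodule.mem_sup_left hP.2)
  obtain ⟨φ, hφ⟩ := exists_linearMap_apply_eq_one (F := F) (sub_ne_zero.2 hPQ.symm)
  set U := D ⊓ LinearMap.ker φ with hU
  have hUfin := finrank_inf_ker hQPD hφ
  have hQPU : Q - P ∉ U := fun h => by
    have : φ (Q - P) = 0 := h.2
    rw [hφ] at this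
    exact one_ne_zero this
  have hWfin : ∀ v, v ∉ D → Module.finrank F ↥(U ⊔ Submodule.span F {v}) = Module.finrank F D :=
    fun v hv => by
    have hvU : v ∉ U := fun h => hv h.1
    rw [Submodule.finrank_sup_span_singleton hvU, hUfin]
  have hWsub : ∀ v ∈ D', v ∉ D → (z.filter fun x => x - P ∈ U ⊔ Submodule.span F {v}) ⊆
      insert R (z.filter fun x => x - P ∈ U) := fun v hv' hv x hx => by
    rw [Finset.mem_filter] at hx
    have h1 : x - P ∈ D' := sup_le (inf_le_left.trans le_sup_left)
      ((Submodule.span_singleton_le_iff_mem _ _).2 hv') hx.2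
    have h2 : x - a ∈ D' := by simpa using D'.add_mem h1 (Submodule.mem_sup_left hP.2)
    have h3 : x ∈ insert R (z.filter fun x => x - a ∈ D) := by
      rw [hall, Finset.mem_filter]
      exact ⟨hx.1, h2⟩
    rw [Finset.mem_insert, Finset.mem_filter] at h3 ⊢
    refine h3.imp_right fun h4 => ⟨hx.1, ?_⟩
    have h5 : x - P ∈ D := by simpa using D.sub_mem h4.2 hP.2
    have h6 : x - P ∈ (U ⊔ Submodule.span F {v}) ⊓ D := ⟨hx.2, h5⟩
    rwa [sup_span_singleton_inf inf_le_left hv] at h6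
  have hu1 : 0 < cosetCount z P U :=
    Finset.card_pos.2 ⟨P, by simp [hP.1]⟩
  have hu2 : cosetCount z P U < cosetCount z P D := by
    refine Finset.card_lt_card ((Finset.ssubset_iff_of_subset (Finset.monotone_filter_right _
      fun _ _ hx => hx.1)).2 ⟨Q, Finset.mem_filter.2 ⟨hQ.1, hQPD⟩, fun h => ?_⟩)
    exact hQPU (Finset.mem_filter.1 h).2
  rw [cosetCount_congr hP.2] at hu2
  -- If U has at most q - 3 points, tilt through R. Otherwise U has exactly q - 2 ≥ 2 points, and
  -- the tilt must avoid R.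
  rcases Nat.lt_or_ge (cosetCount z P U + 2) (Fintype.card F) with hlt | hge
  · refine ⟨U ⊔ Submodule.span F {R - P}, P, hWfin _ hRPD, ?_, ?_⟩
    · refine two_le_cosetCount hP.1 hR.1 (fun h => hRPD (by simp [h])) (by simp)
        (mem_sup_span_singleton_self _ _)
    · have := (Finset.card_le_card (hWsub _ hRPD' hRPD)).trans (Finset.card_insert_le _ _)
      unfold cosetCount at hlt ⊢
      omega
  · have hv : R - P + (Q - P) ∉ D := fun h => hRPD ((D.add_mem_iff_left hQPD).1 h)
    have hRW : R - P ∉ U ⊔ Submodule.span F {R - P + (Q - P)} := fun h => by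
      obtain ⟨t, ht⟩ := mem_sup_span_singleton_iff.1 h
      have h1 : (1 - t) • (R - P) ∈ D := by
        have := D.add_mem ht.1 (D.smul_mem t hQPD)
        convert this using 1
        module
      by_cases h2 : 1 - t = 0
      · rw [← sub_eq_zero.1 h2, one_smul, sub_add_cancel_left, U.neg_mem_iff] at ht
        exact hQPU ht
      · exact hRPD ((D.smul_mem_iff h2).1 h1)
    refine ⟨U ⊔ Submodule.span F {R - P + (Q - P)}, P, hWfin _ hv, ?_, ?_⟩
    · have : cosetCount z P U ≤ cosetCount z P (U ⊔ Submodule.span F {R - P + (Q - P)}) :=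
        cosetCount_mono le_sup_left
      omega
    · have h1 := hWsub _ (D'.add_mem hRPD' (Submodule.mem_sup_left hQPD)) hv
      have hRf : R ∉ z.filter fun x => x - P ∈ U ⊔ Submodule.span F {R - P + (Q - P)} :=
        fun h => hRW (Finset.mem_filter.1 h).2
      rw [Finset.subset_insert_iff_of_notMem hRf] at h1
      have := Finset.card_le_card h1
      unfold cosetCount at hu2 hD ⊢
      omega

theorem two_mul_pow_le_card_of_not_affine {z : Finset V} {d : ℕ} (H : ParallelCongruent F z d)
    (hdn : d < Module.finrank F V) (hz : ¬ ∃ A : AffineSubspace F V, (A : Set V) = z)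
    (hq : 4 ≤ Fintype.card F) :
    2 * Fintype.card F ^ (Module.finrank F V - d) ≤ z.card := by
  let P : ℕ → Prop := fun k => ∃ (D : Submodule F V) (a : V), Module.finrank F D = k ∧
    2 ≤ cosetCount z a D ∧ cosetCount z a D < Fintype.card F
  have hP : P 1 := exists_line hz (by omega)
  have hle : 1 ≤ d := by
    obtain ⟨D, a, h1, h2, h3⟩ := hP
    by_contra! hlt
    exact Nat.not_dvd_of_pos_of_lt (by omega) h3 (H.card_dvd (by omega) a)
  rcases exists_last_or hP hle with ⟨D, a, h1, h2, h3⟩ | ⟨k, -, hkd, ⟨D, a, h1, h2, h3⟩, hnot⟩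
  · have htwo : ∀ b, 2 ≤ cosetCount z b D := fun b => by
      by_contra! hb
      have h4 := (H D a b h1.ge).eq_of_lt_of_lt h3 (by omega)
      omega
    have := mul_pow_le_card htwo
    rwa [h1] at this
  · have hext : ∀ (W : Submodule F V) (b : V), Module.finrank F W = k → 2 ≤ cosetCount z b W →
        ∀ y ∉ W, Fintype.card F ≤ cosetCount z b (W ⊔ Submodule.span F {y}) :=
      fun W b hW hb y hy => by
      have h4 : cosetCount z b W ≤ cosetCount z b (W ⊔ Submodule.span F {y}) :=
        cosetCount_mono le_sup_left
      by_contra! h5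
      exact hnot ⟨_, b, by rw [Submodule.finrank_sup_span_singleton hy, hW], by omega, h5⟩
    have hfinish : ∀ (W : Submodule F V) (b : V), Module.finrank F W = k → (∀ y ∉ W,
        2 + cosetCount z b W ≤ cosetCount z b (W ⊔ Submodule.span F {y})) →
        2 * Fintype.card F ^ (Module.finrank F V - d) ≤ z.card := fun W b hW hb =>
      (Nat.le_add_left _ _).trans (add_mul_pow_le_card hdn (by omega) hb)
    -- Extensions have at least q points, so a gain below 2 means counts q - 1 and q; the section is
    -- then replaced by one with at most q - 2 points.
    by_cases hall : ∀ y ∉ D, 2 + cosetCount z a D ≤ cosetCount z a (D ⊔ Submodule.span F {y})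
    · exact hfinish D a h1 hall
    · push Not at hall
      obtain ⟨y, hy, hlt⟩ := hall
      have h4 := hext D a h1 h2 y hy
      obtain ⟨W, b, hW, hb1, hb2⟩ := exists_smaller_section (z := z) hq (D := D) (y := y) (a := a) (by omega)
        (by omega)
      refine hfinish W b (hW.trans h1) fun y hy => ?_
      have := hext W b (hW.trans h1) hb1 y hy
      omega

end LowerBounds

/-! ### Cones: counting lines through the origin. -/

section Cones

variable {F V : Type*} [Field F] [AddCommGroup V] [Module F V]

open Classical in
/-- The lines through the origin spanned by the nonzero points of `z`. -/
noncomputable def spannedLines (F : Type*) {V : Type*} [Field F] [AddCommGroup V] [Module F V]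
    (z : Finset V) : Finset (Submodule F V) :=
  (z.filter fun x => x ≠ 0).image fun x => Submodule.span F {x}

open Classical in
/-- The number of lines spanned by points of `z` that lie in `D`. -/
noncomputable def lineCount (z : Finset V) (D : Submodule F V) : ℕ :=
  ((spannedLines F z).filter fun L => L ≤ D).card

lemma mem_spannedLines {z : Finset V} {L : Submodule F V} :
    L ∈ spannedLines F z ↔ ∃ x ∈ z, x ≠ 0 ∧ Submodule.span F {x} = L := by
  simp [spannedLines, and_assoc]

lemma lineCount_mono {z : Finset V} {D E : Submodule F V} (h : D ≤ E) :
    lineCount z D ≤ lineCount z E := by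
  classical
  exact Finset.card_le_card (Finset.monotone_filter_right _ fun _ _ hx => hx.trans h)

lemma two_le_lineCount {z : Finset V} {D L₁ L₂ : Submodule F V} (h₁ : L₁ ∈ spannedLines F z)
    (h₂ : L₂ ∈ spannedLines F z) (hne : L₁ ≠ L₂) (hL₁ : L₁ ≤ D) (hL₂ : L₂ ≤ D) :
    2 ≤ lineCount z D := by
  classical
  exact Finset.one_lt_card.2 ⟨L₁, Finset.mem_filter.2 ⟨h₁, hL₁⟩, L₂,
    Finset.mem_filter.2 ⟨h₂, hL₂⟩, hne⟩

lemma span_singleton_eq_of_mem {x y : V} (hx : x ≠ 0) (h : x ∈ Submodule.span F {y}) :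
    Submodule.span F {x} = Submodule.span F {y} := by
  obtain ⟨c, rfl⟩ := Submodule.mem_span_singleton.1 h
  have hc : c ≠ 0 := by
    rintro rfl
    simp at hx
  exact Submodule.span_singleton_smul_eq hc.isUnit y

lemma cosetCount_zero_eq [Fintype F] {z : Finset V} (h0 : 0 ∈ z)
    (hcone : ∀ x ∈ z, ∀ c : F, c • x ∈ z) (D : Submodule F V) :
    cosetCount z 0 D = 1 + (Fintype.card F - 1) * lineCount z D := by
  classical
  have h1 : (z.filter fun x => x - 0 ∈ D) = insert 0 (z.filter fun x => x ≠ 0 ∧ x ∈ D) := by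
    ext x
    simp only [sub_zero, Finset.mem_filter, Finset.mem_insert]
    by_cases hx : x = 0
    · simp [hx, h0]
    · simp [hx]
  rw [cosetCount, h1, Finset.card_insert_of_notMem (by simp), add_comm]
  congr 1
  rw [Finset.card_eq_sum_card_fiberwise (f := fun x => Submodule.span F {x})
    (t := (spannedLines F z).filter fun L => L ≤ D) (fun x hx => by
      simp only [Finset.coe_filter, Set.mem_ofPred_eq, Submodule.span_singleton_le_iff_mem] at hx ⊢
      exact ⟨mem_spannedLines.2 ⟨x, hx.1, hx.2.1, rfl⟩, hx.2.2⟩)]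
  rw [Finset.sum_congr rfl (g := fun _ => Fintype.card F - 1), Finset.sum_const, smul_eq_mul,
    mul_comm, lineCount]
  intro L hL
  obtain ⟨hL, hLD⟩ := Finset.mem_filter.1 hL
  obtain ⟨x, hx, hx0, rfl⟩ := mem_spannedLines.1 hL
  rw [← Fintype.card_units F, ← Finset.card_univ]
  refine (Finset.card_bij (fun (c : Fˣ) _ => (c : F) • x) ?_ ?_ ?_).symm
  · intro c _
    have hmem : (c : F) • x ∈ Submodule.span F {x} :=
      Submodule.smul_mem _ _ (Submodule.mem_span_singleton_self _)
    have hne : (c : F) • x ≠ 0 := smul_ne_zero c.ne_zero hx0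
    rw [Finset.mem_filter, Finset.mem_filter]
    exact ⟨⟨hcone x hx _, hne, hLD hmem⟩, span_singleton_eq_of_mem hne hmem⟩
  · intro c _ c' _ h
    exact Units.ext (smul_left_injective F hx0 h)
  · intro y hy
    rw [Finset.mem_filter, Finset.mem_filter] at hy
    have hmem : y ∈ Submodule.span F {x} := by
      rw [← hy.2]
      exact Submodule.mem_span_singleton_self _
    obtain ⟨c, rfl⟩ := Submodule.mem_span_singleton.1 hmem
    have hc : c ≠ 0 := by
      rintro rfl
      simp at hy
    exact ⟨Units.mk0 c hc, Finset.mem_univ _, rfl⟩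

/-- A cone that is not a subspace is not closed under addition: some x, y in z have x + y outside z,
and the plane they span misses at least one of its q + 1 lines. -/
lemma exists_plane_of_cone [Fintype F] [Fintype V] {z : Finset V} (h0 : 0 ∈ z)
    (hcone : ∀ x ∈ z, ∀ c : F, c • x ∈ z)
    (hz : ¬ ∃ A : AffineSubspace F V, (A : Set V) = z) :
    ∃ D : Submodule F V, Module.finrank F D = 2 ∧ 2 ≤ lineCount z D ∧
      lineCount z D ≤ Fintype.card F := by
  have hadd : ∃ x ∈ z, ∃ y ∈ z, x + y ∉ z := by
    by_contra! hcon
    exact hz ⟨Submodule.toAffineSubspace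
      ⟨⟨⟨z, fun {x y} hx hy => hcon x hx y hy⟩, h0⟩, fun c x hx => hcone x hx c⟩, rfl⟩
  obtain ⟨x, hx, y, hy, hxy⟩ := hadd
  have hx0 : x ≠ 0 := by
    rintro rfl
    simp [hy] at hxy
  have hy0 : y ≠ 0 := by
    rintro rfl
    simp [hx] at hxy
  have hyx : y ∉ Submodule.span F {x} := fun h => by
    obtain ⟨c, rfl⟩ := Submodule.mem_span_singleton.1 h
    apply hxy
    have := hcone x hx (1 + c)
    rwa [add_smul, one_smul] at this
  have hfin := Submodule.finrank_sup_span_singleton hyx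
  rw [finrank_span_singleton hx0] at hfin
  have hne : Submodule.span F {x} ≠ Submodule.span F {y} := fun h =>
    hyx (h ▸ Submodule.mem_span_singleton_self y)
  refine ⟨_, hfin, two_le_lineCount (mem_spannedLines.2 ⟨x, hx, hx0, rfl⟩)
    (mem_spannedLines.2 ⟨y, hy, hy0, rfl⟩) hne le_sup_left le_sup_right, ?_⟩
  have hlt := cosetCount_lt_of_notMem (z := z) (a := 0) (x := x + y)
    (D := Submodule.span F {x} ⊔ Submodule.span F {y}) (by
      rw [sub_zero]
      exact Submodule.add_mem _ (Submodule.mem_sup_left (Submodule.mem_span_singleton_self _))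
        (Submodule.mem_sup_right (Submodule.mem_span_singleton_self _))) hxy
  rw [cosetCount_zero_eq h0 hcone, hfin] at hlt
  by_contra! hcon
  have h1 := Nat.mul_le_mul_left (Fintype.card F - 1) hcon
  obtain ⟨q, hq⟩ : ∃ q, Fintype.card F = q + 1 := ⟨_, (Nat.sub_add_cancel Fintype.card_pos).symm⟩
  rw [hq, Nat.add_sub_cancel] at hlt h1
  have h2 : (q + 1) ^ (1 + 1) = 1 + q * (q + 1).succ := by
    rw [Nat.succ_eq_add_one]
    ring
  omega

/-- Two planes through a common line of D, one inside D and one leaving it, share only that line;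
the poorer one has at most about half of the lines. -/
lemma exists_small_plane [FiniteDimensional F V] {z : Finset V} {D E : Submodule F V} (hDE : D ≤ E)
    (h2 : 2 ≤ lineCount z D) (hlt : lineCount z D < lineCount z E) :
    ∃ C ≤ E, Module.finrank F C = 2 ∧ 2 ≤ lineCount z C ∧ 2 * lineCount z C ≤ lineCount z E + 1 := by
  classical
  obtain ⟨L₀, hL₀, L₁, hL₁, hne⟩ := Finset.one_lt_card.1
    (show 1 < ((spannedLines F z).filter fun L => L ≤ D).card from h2)
  rw [Finset.mem_filter] at hL₀ hL₁
  obtain ⟨L₂, hL₂, hL₂D⟩ := Finset.exists_mem_notMem_of_card_lt_card hlt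
  rw [Finset.mem_filter] at hL₂
  replace hL₂D : ¬ L₂ ≤ D := fun h => hL₂D (Finset.mem_filter.2 ⟨hL₂.1, h⟩)
  obtain ⟨u, hu, hu0, rfl⟩ := mem_spannedLines.1 hL₀.1
  obtain ⟨w, hw, hw0, rfl⟩ := mem_spannedLines.1 hL₁.1
  obtain ⟨v, hv, hv0, rfl⟩ := mem_spannedLines.1 hL₂.1
  have hvD : v ∉ D := fun h => hL₂D ((Submodule.span_singleton_le_iff_mem _ _).2 h)
  have hwu : w ∉ Submodule.span F {u} := fun h => hne (span_singleton_eq_of_mem hw0 h).symm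
  have hvu : v ∉ Submodule.span F {u} := fun h => hvD (hL₀.2 h)
  have hfin : ∀ x, x ∉ Submodule.span F {u} →
      Module.finrank F ↥(Submodule.span F {u} ⊔ Submodule.span F {x}) = 2 := fun x hx => by
    rw [Submodule.finrank_sup_span_singleton hx, finrank_span_singleton hu0]
  set A := Submodule.span F {u} ⊔ Submodule.span F {w} with hA
  set B := Submodule.span F {u} ⊔ Submodule.span F {v} with hB
  have hAD : A ≤ D := sup_le hL₀.2 hL₁.2
  have hAE : A ≤ E := hAD.trans hDE
  have hBE : B ≤ E := sup_le (hL₀.2.trans hDE) hL₂.2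
  have hA2 : 2 ≤ lineCount z A := two_le_lineCount hL₀.1 hL₁.1 hne le_sup_left le_sup_right
  have hB2 : 2 ≤ lineCount z B := two_le_lineCount hL₀.1 hL₂.1
    (fun h => hvu (h ▸ Submodule.mem_span_singleton_self v)) le_sup_left le_sup_right
  have hsum : lineCount z A + lineCount z B ≤ lineCount z E + 1 := by
    rw [lineCount, lineCount, ← Finset.card_union_add_card_inter]
    refine add_le_add (Finset.card_le_card (Finset.union_subset ?_ ?_)) ?_
    · exact Finset.monotone_filter_right _ fun _ _ hx => hx.trans hAE
    · exact Finset.monotone_filter_right _ fun _ _ hx => hx.trans hBE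
    · rw [← Finset.card_singleton (Submodule.span F {u})]
      refine Finset.card_le_card fun L hL => ?_
      rw [Finset.mem_inter, Finset.mem_filter, Finset.mem_filter] at hL
      have h1 : L ≤ B ⊓ D := le_inf hL.2.2 (hL.1.2.trans hAD)
      rw [hB, sup_span_singleton_inf hL₀.2 hvD] at h1
      obtain ⟨x, hx, hx0, rfl⟩ := mem_spannedLines.1 hL.1.1
      rw [Finset.mem_singleton]
      exact span_singleton_eq_of_mem hx0 ((Submodule.span_singleton_le_iff_mem _ _).1 h1)
  rcases le_total (lineCount z A) (lineCount z B) with hle | hle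
  · exact ⟨A, hAE, hfin w hwu, hA2, by omega⟩
  · exact ⟨B, hBE, hfin v hvu, hB2, by omega⟩

variable [Fintype F] [Fintype V]

lemma lineCount_sub_one_dvd {z : Finset V} {d : ℕ} (H : ParallelCongruent F z d) (h0 : 0 ∈ z)
    (hcone : ∀ x ∈ z, ∀ c : F, c • x ∈ z) {D : Submodule F V} (hD : d < Module.finrank F D)
    (h1 : 1 ≤ lineCount z D) : Fintype.card F ∣ lineCount z D - 1 := by
  have h2 := H.card_dvd hD 0
  rw [cosetCount_zero_eq h0 hcone] at h2
  obtain ⟨m, hm⟩ : ∃ m, lineCount z D = m + 1 := ⟨_, (Nat.sub_add_cancel h1).symm⟩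
  obtain ⟨q, hq⟩ : ∃ q, Fintype.card F = q + 1 := ⟨_, (Nat.sub_add_cancel Fintype.card_pos).symm⟩
  rw [hm, hq, Nat.add_sub_cancel] at h2 ⊢
  have h3 : (1 + q * (m + 1)) + m = (q + 1) * (m + 1) := by ring
  exact (Nat.dvd_add_right h2).1 (h3.symm ▸ dvd_mul_right _ _)

/-- With L lines the count is 1 + (q - 1)L = (q + 1 - L) + q(L - 1), so every parallel coset has at
least the residue q + 1 - L. Fewer lines give a better bound. -/
lemma mul_pow_le_card_of_lineCount {z : Finset V} {d : ℕ} (H : ParallelCongruent F z d)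
    (h0 : 0 ∈ z) (hcone : ∀ x ∈ z, ∀ c : F, c • x ∈ z) {D : Submodule F V}
    (hD : Module.finrank F D = d) (h2 : 2 ≤ lineCount z D) (hq : lineCount z D ≤ Fintype.card F) :
    (Fintype.card F + 1 - lineCount z D) * Fintype.card F ^ (Module.finrank F V - d) ≤ z.card := by
  rw [← hD]
  refine mul_pow_le_card fun b => ?_
  have h3 := H D b 0 hD.ge
  have h4 : cosetCount z 0 D =
      (Fintype.card F + 1 - lineCount z D) + Fintype.card F * (lineCount z D - 1) := by
    rw [cosetCount_zero_eq h0 hcone]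
    obtain ⟨m, hm⟩ : ∃ m, lineCount z D = m + 1 := ⟨_, (Nat.sub_add_cancel (by omega)).symm⟩
    obtain ⟨q, hq'⟩ : ∃ q, Fintype.card F = q + 1 :=
      ⟨_, (Nat.sub_add_cancel Fintype.card_pos).symm⟩
    rw [hm, hq'] at hq ⊢
    obtain ⟨s, rfl⟩ := Nat.exists_eq_add_of_le (show m ≤ q by omega)
    rw [show m + s + 1 + 1 - (m + 1) = s + 1 by omega, Nat.add_sub_cancel, Nat.add_sub_cancel]
    ring
  rw [h4, Nat.ModEq, Nat.add_mul_mod_self_left, Nat.mod_eq_of_lt (b := Fintype.card F)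
    (a := Fintype.card F + 1 - lineCount z D) (by omega)] at h3
  rw [← h3]
  exact Nat.mod_le _ _

/-- E has just q^2 points. If X has codimension at least 2 in E and every extension gained a line,
the double count would give E at least q^2 - 1 + q points. -/
lemma exists_extension_lineCount_eq {z : Finset V} (h0 : 0 ∈ z)
    (hcone : ∀ x ∈ z, ∀ c : F, c • x ∈ z) {C E : Submodule F V} (hCE : C ≤ E)
    (hC : 1 ≤ lineCount z C) (hE : lineCount z E = Fintype.card F + 1) {j : ℕ}
    (hj : Module.finrank F C ≤ j) (hjE : j < Module.finrank F E) :
    ∃ X ≤ E, Module.finrank F X = j ∧ lineCount z X = lineCount z C := by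
  induction j, hj using Nat.le_induction with
  | base => exact ⟨C, hCE, rfl, rfl⟩
  | succ j hj ih =>
    obtain ⟨X, hXE, hXj, hXC⟩ := ih (by omega)
    by_contra! hcon
    have hq : 1 < Fintype.card F := Fintype.one_lt_card
    have hext := mul_pow_sub_one_le_of_extensions (z := z) (a := 0) hXE
      (c := Fintype.card F - 1) fun y hyE hyX => by
      have h1 := hcon (X ⊔ Submodule.span F {y})
        (sup_le hXE ((Submodule.span_singleton_le_iff_mem _ _).2 hyE))
        (by rw [Submodule.finrank_sup_span_singleton hyX, hXj])
      have h2 : lineCount z X ≤ lineCount z (X ⊔ Submodule.span F {y}) :=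
        lineCount_mono le_sup_left
      have h3 : lineCount z X + 1 ≤ lineCount z (X ⊔ Submodule.span F {y}) := by omega
      have h4 := Nat.mul_le_mul_left (Fintype.card F - 1) h3
      rw [mul_add, mul_one] at h4
      rw [cosetCount_zero_eq h0 hcone, cosetCount_zero_eq h0 hcone]
      omega
    rw [mul_comm, ← add_mul] at hext
    have h5 := Nat.le_of_mul_le_mul_right hext (by omega)
    rw [cosetCount_zero_eq h0 hcone, cosetCount_zero_eq h0 hcone, hE] at h5
    have h6 : Fintype.card F ^ 2 ≤ Fintype.card F ^ (Module.finrank F E - Module.finrank F X) :=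
      Nat.pow_le_pow_right (by omega) (by omega)
    obtain ⟨q, hq'⟩ : ∃ q, Fintype.card F = q + 1 := ⟨_, (Nat.sub_add_cancel (by omega)).symm⟩
    rw [hq'] at h5 h6 hq
    rw [Nat.add_sub_cancel] at h5
    have h7 : q * 1 ≤ q * lineCount z X := Nat.mul_le_mul_left _ (by omega)
    have h8 : (q + 1) ^ 2 = 1 + q * (q + 1 + 1) := by ring
    omega

theorem pow_le_two_mul_card_of_cone {z : Finset V} {d : ℕ} (H : ParallelCongruent F z d)
    (hdn : d < Module.finrank F V) (h0 : 0 ∈ z) (hcone : ∀ x ∈ z, ∀ c : F, c • x ∈ z)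
    (hz : ¬ ∃ A : AffineSubspace F V, (A : Set V) = z) :
    Fintype.card F ^ (Module.finrank F V - d + 1) ≤ 2 * z.card := by
  let P : ℕ → Prop := fun k => ∃ D : Submodule F V, Module.finrank F D = k ∧
    2 ≤ lineCount z D ∧ lineCount z D ≤ Fintype.card F
  have hq : 1 < Fintype.card F := Fintype.one_lt_card
  have hP : P 2 := exists_plane_of_cone h0 hcone hz
  have hle : 2 ≤ d := by
    obtain ⟨D, h1, h2, h3⟩ := hP
    by_contra! hlt
    have := Nat.le_of_dvd (by omega)
      (lineCount_sub_one_dvd H h0 hcone (D := D) (by omega) (by omega))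
    omega
  have hcount := cosetCount_zero_eq h0 hcone
  rcases exists_last_or hP hle with ⟨D, h1, h2, h3⟩ | ⟨k, -, hkd, ⟨D, h1, h2, h3⟩, hnot⟩
  -- If every extension has at least 2q + 1 lines, each gains at least q + 1. Otherwise some
  -- extension E has at most 2q lines, and being 1 modulo q this number is q + 1.
  · by_cases hall : ∀ y ∉ D, 2 * Fintype.card F + 1 ≤ lineCount z (D ⊔ Submodule.span F {y})
    · have hext := mul_pow_sub_one_le_of_extensions (z := z) (a := 0) (D := D) (E := ⊤) le_top
        (c := (Fintype.card F - 1) * (Fintype.card F + 1)) fun y _ hy => by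
          have h4 := hall y hy
          have h5 := Nat.mul_le_mul_left (Fintype.card F - 1)
            (show Fintype.card F + 1 + lineCount z D ≤
              lineCount z (D ⊔ Submodule.span F {y}) by omega)
          rw [mul_add] at h5
          rw [hcount, hcount]
          omega
      rw [cosetCount_top, finrank_top, h1, mul_assoc, mul_comm, ← add_mul] at hext
      have h6 := Nat.le_of_mul_le_mul_right hext (by omega)
      rw [hcount] at h6
      have h7 := Nat.mul_le_mul_left (Fintype.card F - 1) h2
      have h8 : Fintype.card F ≤ Fintype.card F ^ (Module.finrank F V - d) :=
        Nat.le_self_pow (by omega) _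
      rw [pow_succ]
      generalize Fintype.card F ^ (Module.finrank F V - d) = Y at *
      obtain ⟨Y, rfl⟩ : ∃ t, Y = t + 1 := ⟨Y - 1, by omega⟩
      obtain ⟨q, hq'⟩ : ∃ q, Fintype.card F = q + 1 := ⟨_, (Nat.sub_add_cancel (by omega)).symm⟩
      rw [hq'] at h6 h7 h8 hq ⊢
      simp only [Nat.add_sub_cancel] at h6 h7
      nlinarith
    · push Not at hall
      obtain ⟨y, hy, hlt⟩ := hall
      set E := D ⊔ Submodule.span F {y} with hE
      have hEfin : Module.finrank F E = d + 1 := by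
        rw [hE, Submodule.finrank_sup_span_singleton hy, h1]
      have hDE : lineCount z D ≤ lineCount z E := lineCount_mono le_sup_left
      obtain ⟨t, ht⟩ := lineCount_sub_one_dvd H h0 hcone (D := E) (by omega) (by omega)
      have ht1 : t = 1 := by
        have h4 : 0 < t := Nat.pos_of_ne_zero fun h => by
          rw [h, mul_zero] at ht
          omega
        have h5 : t < 2 := by
          by_contra! h5
          have := Nat.mul_le_mul_left (Fintype.card F) h5
          omega
        omega
      rw [ht1, mul_one] at ht
      -- C has at most (q + 2)/2 lines; thickened to dimension d without new lines, it leaves a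
      -- residue of at least q/2.
      obtain ⟨C, hCE, hCfin, hC2, hC⟩ := exists_small_plane (z := z) (D := D) (E := E)
        le_sup_left h2 (by omega)
      obtain ⟨X, -, hXd, hXC⟩ := exists_extension_lineCount_eq h0 hcone hCE (by omega) (by omega)
        (j := d) (by omega) (by omega)
      have h4 := mul_pow_le_card_of_lineCount H h0 hcone hXd (by omega) (by omega)
      have h5 : Fintype.card F ≤ 2 * (Fintype.card F + 1 - lineCount z X) := by omega
      calc Fintype.card F ^ (Module.finrank F V - d + 1)
          = Fintype.card F * Fintype.card F ^ (Module.finrank F V - d) := pow_succ' _ _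
        _ ≤ 2 * (Fintype.card F + 1 - lineCount z X) *
            Fintype.card F ^ (Module.finrank F V - d) := Nat.mul_le_mul_right _ h5
        _ ≤ _ := by rw [mul_assoc]; exact Nat.mul_le_mul_left _ h4
  · have hext := mul_pow_sub_one_le_of_extensions (z := z) (a := 0) (D := D) (E := ⊤) le_top
      (c := Fintype.card F - 1) fun y _ hy => by
        have h4 : lineCount z D ≤ lineCount z (D ⊔ Submodule.span F {y}) :=
          lineCount_mono le_sup_left
        have h5 : Fintype.card F + 1 ≤ lineCount z (D ⊔ Submodule.span F {y}) := by
          by_contra! h6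
          exact hnot ⟨_, by rw [Submodule.finrank_sup_span_singleton hy, h1], by omega, by omega⟩
        have h6 := Nat.mul_le_mul_left (Fintype.card F - 1)
          (show lineCount z D + 1 ≤ lineCount z (D ⊔ Submodule.span F {y}) by omega)
        rw [mul_add, mul_one] at h6
        rw [hcount, hcount]
        omega
    rw [cosetCount_top, finrank_top, h1, mul_comm, ← add_mul] at hext
    have h6 := Nat.le_of_mul_le_mul_right hext (by omega)
    rw [hcount] at h6
    have h7 : Fintype.card F ^ (Module.finrank F V - d + 1) ≤
        Fintype.card F ^ (Module.finrank F V - k) := Nat.pow_le_pow_right (by omega) (by omega)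
    omega

end Cones

/-! ### Homogeneous polynomials and the final assembly. -/

lemma MvPolynomial.IsHomogeneous.eval_smul {R σ : Type*} [CommSemiring R] {φ : MvPolynomial σ R}
    {m : ℕ} (hφ : φ.IsHomogeneous m) (c : R) (x : σ → R) :
    MvPolynomial.eval (c • x) φ = c ^ m * MvPolynomial.eval x φ := by
  rw [MvPolynomial.eval_eq, MvPolynomial.eval_eq, Finset.mul_sum]
  refine Finset.sum_congr rfl fun w hw => ?_
  have hdeg : ∑ i ∈ w.support, w i = m := by
    rw [← hφ (MvPolynomial.mem_support_iff.1 hw)]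
    exact congrFun (congrArg DFunLike.coe (Finsupp.degree_eq_weight_one (R := ℕ))) w
  simp only [Pi.smul_apply, smul_eq_mul, mul_pow, Finset.prod_mul_distrib]
  rw [Finset.prod_pow_eq_pow_sum, hdeg, mul_left_comm]

theorem theorem2 {F : Type*} [Field F] [Fintype F] (n r : ℕ)
    (f : Fin r → MvPolynomial (Fin n) F)
    (hdn : degreeSum f < n)
    (hne : (zeroSet f Set.univ).Nonempty)
    (hlin : ¬ ∃ A : AffineSubspace F (Fin n → F), (A : Set (Fin n → F)) = zeroSet f Set.univ) :
    (Fintype.card F) ^ (n - degreeSum f) < numZeros f Set.univ ∧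
    (4 ≤ Fintype.card F →
      2 * (Fintype.card F) ^ (n - degreeSum f) ≤ numZeros f Set.univ) ∧
    ((∀ i, (f i).IsHomogeneous (f i).totalDegree) →
      (Fintype.card F : ℝ) ^ (n + 1 - degreeSum f) / ((n : ℝ) + 2 - (degreeSum f : ℝ))
        ≤ (numZeros f Set.univ : ℝ)) := by
  classical
  have hcoe : (zeroFinset f : Set (Fin n → F)) = zeroSet f Set.univ := by
    ext x
    simp [zeroSet, mem_zeroFinset]
  have hN : numZeros f Set.univ = (zeroFinset f).card := by
    rw [numZeros, ← hcoe, Set.ncard_coe_finset]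
  have H : ParallelCongruent F (zeroFinset f) (degreeSum f) := fun D a b hD =>
    cosetCount_zeroFinset_modEq f D hD a b
  have hfin : Module.finrank F (Fin n → F) = n := Module.finrank_fin_fun F
  have hdn' : degreeSum f < Module.finrank F (Fin n → F) := by rwa [hfin]
  rw [← hcoe] at hlin hne
  rw [hN]
  refine ⟨?_, fun hq => ?_, fun hhom => ?_⟩
  · have := pow_lt_card_of_not_affine H hdn' hlin
    rwa [hfin] at this
  · have := two_mul_pow_le_card_of_not_affine H hdn' hlin hq
    rwa [hfin] at this
  · have hcone : ∀ x ∈ zeroFinset f, ∀ c : F, c • x ∈ zeroFinset f := fun x hx c => by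
      rw [mem_zeroFinset] at hx ⊢
      intro i
      rw [(hhom i).eval_smul, hx i, mul_zero]
    have h0 : (0 : Fin n → F) ∈ zeroFinset f := by
      obtain ⟨x, hx⟩ := hne
      simpa using hcone x hx 0
    have h1 := pow_le_two_mul_card_of_cone H hdn' h0 hcone hlin
    rw [hfin, show n - degreeSum f + 1 = n + 1 - degreeSum f by omega] at h1
    have h2 : ((degreeSum f : ℕ) : ℝ) < n := by exact_mod_cast hdn
    have h3 : (Fintype.card F : ℝ) ^ (n + 1 - degreeSum f) ≤ 2 * ((zeroFinset f).card : ℝ) := by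
      exact_mod_cast h1
    have h4 : (0 : ℝ) ≤ (zeroFinset f).card := Nat.cast_nonneg _
    -- The denominator n + 2 - d exceeds 2, so q^(n+1-d) ≤ 2N suffices.
    rw [div_le_iff₀ (by linarith)]
    nlinarith
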